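/- **Conventions.** For integers $0\le n\le p$, $0\le m\le q$, reals $\alpha_j,\beta_j$ and reals $A_j,B_j>0$, let $$\Xi^{m,n}_{p,q}(s)=\frac{\prod_{j=1}^m\Gamma(\beta_j+B_js)\prod_{j=1}^n\Gamma(1-\alpha_j-A_js)}{\prod_{j=m+1}^q\Gamma(1-\beta_j-B_js)\prod_{j=n+1}^p\Gamma(\alpha_j+A_js)},$$ where it is required that no pole of a factor $\Gamma(\beta_j+B_js)$, $j\le m$, is a pole of a factor $\Gamma(1-\alpha_j-A_js)$, $j\le n$. Put $$\chi=\sum_{j=1}^nA_j-\sum_{j=n+1}^pA_j+\sum_{j=1}^mB_j-\sum_{j=m+1}^qB_j,\qquad \ell=-\min_{1\le j\le m}\frac{\beta_j}{B_j},\qquad u=\min_{1\le j\le n}\frac{1-\alpha_j}{A_j},$$ with the minimum over the empty set equal to $+\infty$. If $\ell<u$, the Fox $H$-function is $$H^{m,n}_{p,q}\left[t\,\Big|\begin{array}{l}(\alpha_j,A_j)_1^p\\(\beta_j,B_j)_1^q\end{array}\right]=\frac1{2\pi i}\int_{c-i\infty}^{c+i\infty}\Xi^{m,n}_{p,q}(s)\,t^{-s}\,ds,\qquad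 t>0,\ \ell<c<u$$ (for $\chi>0$ the integral converges absolutely and does not depend on $c$). **Statement.** Let $H'$ and $H''$ be Fox $H$-functions with indexes $m',n',p',q'$ and $m'',n'',p'',q''$ and parameters $(\alpha'_j,A'_j)_1^{p'},(\beta'_j,B'_j)_1^{q'}$ and $(\alpha''_j,A''_j)_1^{p''},(\beta''_j,B''_j)_1^{q''}$, both positive on $(0,\infty)$, with $\chi',\chi''>0$, $\ell'<u'$ and $\ell''<u''$. Let $\lambda>0$. (i) There are real $\omega$ with $\lambda\ell'+\ell''<\omega<\lambda u'+u''$, and for each such $\omega$ the Fox $H$-function $$H'''(t)=H^{m'+n'',\,n'+m''}_{p'+q'',\,q'+p''}\left[t\,\Big|\begin{array}{l}(\alpha'_j,A'_j)_1^{n'},\ (1-\beta''_j-\omega B''_j,\lambda B''_j)_1^{q''},\ (\alpha'_j,A'_j)_{n'+1}^{p'}\\(\beta'_j,B'_j)_1^{m'},\ (1-\alpha''_j-\omega A''_j,\lambda A''_j)_1^{p''},\ (\beta'_j,B'_j)_{m'+1}^{q'}\end{array}\right]$$ satisfies the above requirement on the poles, and for all $\xi,\zeta>0$ $$\int_0^\infty\tau^{\omega-1}H'(\xi\tau^{\lambda})\,H''(\zeta\tau)\,d\tau=\zeta^{-\omega}H'''(\xi\zeta^{-\lambda}),$$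 the integral being absolutely convergent; moreover $H'''(t)>0$ for every $t>0$. (ii) Likewise, there are real $\omega$ with $\ell''-\lambda u'<\omega<u''-\lambda\ell'$, and for each such $\omega$ the Fox $H$-function $$\widetilde H(t)=H^{m'+m'',\,n'+n''}_{p'+p'',\,q'+q''}\left[t\,\Big|\begin{array}{l}(\alpha'_j,A'_j)_1^{n'},\ (\alpha''_j+\omega A''_j,\lambda A''_j)_1^{p''},\ (\alpha'_j,A'_j)_{n'+1}^{p'}\\(\beta'_j,B'_j)_1^{m'},\ (\beta''_j+\omega B''_j,\lambda B''_j)_1^{q''},\ (\beta'_j,B'_j)_{m'+1}^{q'}\end{array}\right]$$ satisfies the requirement on the poles, and for all $\xi,\zeta>0$ $$\int_0^\infty\tau^{\omega-1}H'(\xi\tau^{-\lambda})\,H''(\zeta\tau)\,d\tau=\zeta^{-\omega}\,\widetilde H(\xi\zeta^{\lambda}),$$ the integral being absolutely convergent; moreover $\widetilde H(t)>0$ for every $t>0$. -/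

import Mathlib

open MeasureTheory Set

noncomputable section

/-- Indexes and (real) parameters of a Fox `H`-function `H^{m,n}_{p,q}`:
`a` is the list `(α_1, A_1), …, (α_p, A_p)` and `b` is the list `(β_1, B_1), …, (β_q, B_q)`. -/
structure FoxData where
  m : ℕ
  n : ℕ
  a : List (ℝ × ℝ)
  b : List (ℝ × ℝ)

namespace FoxData

/-- The index `p`. -/
def p (F : FoxData) : ℕ := F.a.length

/-- The index `q`. -/
def q (F : FoxData) : ℕ := F.b.length

/-- The standing requirements on indexes and parameters: `0 ≤ n ≤ p`, `0 ≤ m ≤ q`, `A_j, B_j > 0`,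
and no pole of a `Γ(β_j + B_j s)`, `j ≤ m`, is a pole of a `Γ(1 - α_j - A_j s)`, `j ≤ n`. -/
structure IsAdmissible (F : FoxData) : Prop where
  n_le : F.n ≤ F.p
  m_le : F.m ≤ F.q
  a_pos : ∀ x ∈ F.a, 0 < x.2
  b_pos : ∀ y ∈ F.b, 0 < y.2
  poles_ne : ∀ x ∈ F.a.take F.n, ∀ y ∈ F.b.take F.m, ∀ l l' : ℕ,
    x.2 * ((l : ℝ) + y.1) ≠ y.2 * (x.1 - (l' : ℝ) - 1)

/-- The Mellin-Barnes kernel `Ξ^{m,n}_{p,q}(s)`. -/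
def kernel (F : FoxData) (s : ℂ) : ℂ :=
  (((F.b.take F.m).map fun y => Complex.Gamma ((y.1 : ℂ) + (y.2 : ℂ) * s)).prod *
    ((F.a.take F.n).map fun x => Complex.Gamma (1 - (x.1 : ℂ) - (x.2 : ℂ) * s)).prod) /
  (((F.b.drop F.m).map fun y => Complex.Gamma (1 - (y.1 : ℂ) - (y.2 : ℂ) * s)).prod *
    ((F.a.drop F.n).map fun x => Complex.Gamma ((x.1 : ℂ) + (x.2 : ℂ) * s)).prod)

/-- The parameter `χ`. -/
def chi (F : FoxData) : ℝ :=
  ((F.a.take F.n).map Prod.snd).sum - ((F.a.drop F.n).map Prod.snd).sum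
    + ((F.b.take F.m).map Prod.snd).sum - ((F.b.drop F.m).map Prod.snd).sum

/-- `- min_{j ≤ m} β_j / B_j`, the abscissa of the rightmost pole of the `Γ(β_j + B_j s)`, `j ≤ m`
(it is `-∞` if `m = 0`). -/
def lower (F : FoxData) : EReal :=
  -(⨅ y ∈ F.b.take F.m, ((y.1 / y.2 : ℝ) : EReal))

/-- `min_{j ≤ n} (1 - α_j) / A_j`, the abscissa of the leftmost pole of the
`Γ(1 - α_j - A_j s)`, `j ≤ n` (it is `+∞` if `n = 0`). -/
def upper (F : FoxData) : EReal :=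
  ⨅ x ∈ F.a.take F.n, (((1 - x.1) / x.2 : ℝ) : EReal)

open Classical in
/-- The Fox `H`-function on the positive half-line, for parameters such that `lower < upper`:
`H(t) = (1 / 2πi) ∫_{C} Ξ(s) t^{-s} ds`, where the contour `C` is a vertical line `Re s = c`,
oriented upwards, that separates the two families of poles, `lower < c < upper`. Here
`mellinInv c Ξ t = (1 / 2π) ∫_ℝ t^{-(c + iy)} Ξ(c + iy) dy`. When `χ > 0` the integral converges
absolutely and does not depend on `c`. -/
def foxH (F : FoxData) (t : ℝ) : ℂ :=
  if h : ∃ c : ℝ, F.lower < (c : EReal) ∧ (c : EReal) < F.upper then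
    mellinInv h.choose F.kernel t
  else 0

/-- The Fox `H`-function is (real and) positive on the positive half-line. -/
def IsPositive (F : FoxData) : Prop :=
  ∀ t : ℝ, 0 < t → (F.foxH t).im = 0 ∧ 0 < (F.foxH t).re

/-- The data of index `H^{m+n'', n+m''}_{p+q'', q+p''}` with upper parameters
`(α_j, A_j)_1^n, (1 - β''_j - ω B''_j, λ B''_j)_1^{q''}, (α_j, A_j)_{n+1}^p` and lower parameters
`(β_j, B_j)_1^m, (1 - α''_j - ω A''_j, λ A''_j)_1^{p''}, (β_j, B_j)_{m+1}^q`. -/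
def product (F G : FoxData) (lam ω : ℝ) : FoxData where
  m := F.m + G.n
  n := F.n + G.m
  a := F.a.take F.n ++ G.b.map (fun y => (1 - y.1 - ω * y.2, lam * y.2)) ++ F.a.drop F.n
  b := F.b.take F.m ++ G.a.map (fun x => (1 - x.1 - ω * x.2, lam * x.2)) ++ F.b.drop F.m

/-- The data of index `H^{m+m'', n+n''}_{p+p'', q+q''}` with upper parameters
`(α_j, A_j)_1^n, (α''_j + ω A''_j, λ A''_j)_1^{p''}, (α_j, A_j)_{n+1}^p` and lower parameters
`(β_j, B_j)_1^m, (β''_j + ω B''_j, λ B''_j)_1^{q''}, (β_j, B_j)_{m+1}^q`. -/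
def productInv (F G : FoxData) (lam ω : ℝ) : FoxData where
  m := F.m + G.m
  n := F.n + G.n
  a := F.a.take F.n ++ G.a.map (fun x => (x.1 + ω * x.2, lam * x.2)) ++ F.a.drop F.n
  b := F.b.take F.m ++ G.b.map (fun y => (y.1 + ω * y.2, lam * y.2)) ++ F.b.drop F.m

/-- The constraint on `ω` for the product of `H_F(ξ τ^λ)` and `H_G(ζ τ)`. -/
def OmegaRange (F G : FoxData) (lam ω : ℝ) : Prop :=
  (lam : EReal) * F.lower + G.lower < (ω : EReal) ∧
    (ω : EReal) < (lam : EReal) * F.upper + G.upper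

/-- The constraint on `ω` for the product of `H_F(ξ τ^{-λ})` and `H_G(ζ τ)`. -/
def OmegaRangeInv (F G : FoxData) (lam ω : ℝ) : Prop :=
  G.lower - (lam : EReal) * F.upper < (ω : EReal) ∧
    (ω : EReal) < G.upper - (lam : EReal) * F.lower

end FoxData

end

/-! On a line Re s = c inside its strip, H is the inverse Mellin transform of its kernel Ξ. Each
numerator Gamma factor with coefficient B decays like exp(-Bπ|Im s|/2) up to a power of |Im s|, and
each denominator factor contributes at most the inverse growth, so Ξ decays like exp(-χπ|Im s|/2)
(`verticalDecay_kernel`). For χ > 0 the line can therefore be moved, which bounds H(t) by a multiple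
of t^(-a) for every a in the strip. Hence the Mellin transform of H converges absolutely there, and
Fourier inversion returns Ξ (`mellin_mellinInv`).

Inserting the Mellin-Barnes integral of H'(ξτ^μ), μ = ±λ, and exchanging integrals gives an inverse
Mellin integral of Ξ'(s) Ξ''(ω - μs) (`hasMellin_mul`). The composite parameters are made so that
their kernel is this product (`kernel_product`, `kernel_productInv`), with χ = χ' + λχ'' > 0. The
range of ω guarantees a c in the first strip with ω - μc in the second (`exists_real_sub_mul_mem`);
the line Re s = c then also separates the poles of the composite kernel. Positivity follows by
taking ζ = 1, where the composite function is the integral of a positive function. -/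

namespace Complex

/-! ### Exponential decay of Γ and growth of 1/Γ in vertical strips -/

theorem norm_betaIntegral_le {u v : ℂ} (hu : 0 < u.re) (hv : 0 < v.re) :
    ‖betaIntegral u v‖ ≤ Real.Gamma u.re * Real.Gamma v.re / Real.Gamma (u.re + v.re) := by
  have hre : betaIntegral (u.re : ℂ) (v.re : ℂ) =
      ((Real.Gamma u.re * Real.Gamma v.re / Real.Gamma (u.re + v.re) : ℝ) : ℂ) := by
    rw [betaIntegral_eq_Gamma_mul_div _ _ (by simpa) (by simpa), ← ofReal_add, Gamma_ofReal,
      Gamma_ofReal, Gamma_ofReal]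
    push_cast
    rfl
  -- The modulus of the beta integrand is the integrand with u, v replaced by their real parts.
  have hint : betaIntegral (u.re : ℂ) (v.re : ℂ) =
      ((∫ x : ℝ in 0..1, ‖(x : ℂ) ^ (u - 1) * (1 - (x : ℂ)) ^ (v - 1)‖ : ℝ) : ℂ) := by
    rw [betaIntegral, ← intervalIntegral.integral_ofReal, intervalIntegral.integral_of_le zero_le_one,
      intervalIntegral.integral_of_le zero_le_one, integral_Ioc_eq_integral_Ioo,
      integral_Ioc_eq_integral_Ioo]
    refine setIntegral_congr_fun measurableSet_Ioo fun x hx => ?_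
    have h1 : 0 < 1 - x := sub_pos.2 hx.2
    have h2 : (1 - (x : ℂ)) = ((1 - x : ℝ) : ℂ) := by push_cast; rfl
    simp only [h2]
    rw [norm_mul, norm_cpow_eq_rpow_re_of_pos hx.1, norm_cpow_eq_rpow_re_of_pos h1, ofReal_mul,
      ofReal_cpow hx.1.le, ofReal_cpow h1.le]
    simp
  have h := hint.symm.trans hre
  rw [← ofReal_injective h]
  exact intervalIntegral.norm_integral_le_integral_norm zero_le_one

/-- The quotient `‖Γ(σ + it)‖ / Γ(σ)` is nondecreasing in `σ > 0`. -/
theorem norm_Gamma_le_mul_norm_Gamma_add {s : ℂ} (hs : 0 < s.re) {b : ℝ} (hb : 0 < b) :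
    ‖Gamma s‖ ≤ Real.Gamma s.re / Real.Gamma (s.re + b) * ‖Gamma (s + b)‖ := by
  have h := congrArg norm (Gamma_mul_Gamma_eq_betaIntegral hs (t := (b : ℂ)) (by simpa))
  have hle := norm_betaIntegral_le hs (v := (b : ℂ)) (by simpa)
  have hpos := Real.Gamma_pos_of_pos hb
  rw [norm_mul, norm_mul, Gamma_ofReal, norm_real, Real.norm_of_nonneg hpos.le] at h
  rw [ofReal_re] at hle
  refine le_of_mul_le_mul_right ?_ hpos
  calc ‖Gamma s‖ * Real.Gamma b = ‖Gamma (s + b)‖ * ‖betaIntegral s b‖ := h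
    _ ≤ ‖Gamma (s + b)‖ * (Real.Gamma s.re * Real.Gamma b / Real.Gamma (s.re + b)) := by gcongr
    _ = _ := by ring

theorem norm_Gamma_le_norm_Gamma_add_nat {s : ℂ} (hs : 1 ≤ |s.im|) (n : ℕ) :
    ‖Gamma s‖ ≤ ‖Gamma (s + n)‖ := by
  induction n with
  | zero => simp
  | succ n ih =>
    refine ih.trans ?_
    have him : (s + n).im = s.im := by simp
    have h1 : 1 ≤ ‖s + n‖ := by
      refine hs.trans ?_
      rw [← him]
      exact abs_im_le_norm _
    have h0 : s + n ≠ 0 := norm_pos_iff.1 (by linarith)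
    rw [Nat.cast_succ, ← add_assoc, Gamma_add_one _ h0, norm_mul]
    exact le_mul_of_one_le_left (norm_nonneg _) h1

/-- For s = 1/2 + it one has 1 - s = conj s, so the reflection formula gives |Γ(s)|² = π / cosh(πt).
-/
theorem norm_Gamma_one_half_add_mul_I_le (t : ℝ) :
    ‖Gamma (1 / 2 + t * I)‖ ≤ √(2 * Real.pi) * Real.exp (-(Real.pi / 2) * |t|) := by
  have hrefl := congrArg norm (Gamma_mul_Gamma_one_sub (1 / 2 + t * I))
  have hconj : (1 : ℂ) - (1 / 2 + t * I) = (starRingEnd ℂ) (1 / 2 + t * I) := by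
    apply Complex.ext <;> simp
    norm_num
  have hsin : sin (Real.pi * (1 / 2 + t * I)) = ((Real.cosh (Real.pi * t) : ℝ) : ℂ) := by
    rw [show (Real.pi : ℂ) * (1 / 2 + t * I) = (Real.pi * t : ℝ) * I + Real.pi / 2 by
      push_cast; ring, sin_add_pi_div_two, cos_mul_I, ofReal_cosh]
  rw [hconj, Gamma_conj, norm_mul, norm_conj, hsin, norm_div, norm_real, norm_real,
    Real.norm_of_nonneg Real.pi_pos.le, Real.norm_of_nonneg (Real.cosh_pos _).le] at hrefl
  have hcosh : Real.exp (Real.pi * |t|) / 2 ≤ Real.cosh (Real.pi * t) := by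
    rw [← Real.cosh_abs, abs_mul, abs_of_pos Real.pi_pos, Real.cosh_eq]
    have := Real.exp_pos (-(Real.pi * |t|))
    linarith
  refine le_of_sq_le_sq ?_ (by positivity)
  rw [mul_pow, Real.sq_sqrt (by positivity), ← Real.exp_nat_mul, sq, hrefl,
    div_le_iff₀ (Real.cosh_pos _)]
  calc Real.pi = 2 * Real.pi * Real.exp ((2 : ℕ) * (-(Real.pi / 2) * |t|)) *
        (Real.exp (Real.pi * |t|) / 2) := by
        rw [show ((2 : ℕ) : ℝ) * (-(Real.pi / 2) * |t|) = -(Real.pi * |t|) by push_cast; ring,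
          Real.exp_neg]
        field_simp
    _ ≤ _ := by gcongr

theorem exists_norm_Gamma_nat_add_one_half_le (N : ℕ) :
    ∃ C : ℝ, 0 ≤ C ∧ ∀ t : ℝ, 1 ≤ |t| →
      ‖Gamma (N + 1 / 2 + t * I)‖ ≤ C * |t| ^ N * Real.exp (-(Real.pi / 2) * |t|) := by
  induction N with
  | zero =>
    refine ⟨√(2 * Real.pi), by positivity, fun t _ => ?_⟩
    simpa using norm_Gamma_one_half_add_mul_I_le t
  | succ N ih =>
    obtain ⟨C, hC, h⟩ := ih
    refine ⟨(N + 2) * C, by positivity, fun t ht => ?_⟩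
    have hne : (N + 1 / 2 + t * I : ℂ) ≠ 0 := by
      intro h0
      have := congrArg re h0
      simp at this
      have hN : (0 : ℝ) ≤ N := N.cast_nonneg
      linarith
    have hn : ‖(N + 1 / 2 + t * I : ℂ)‖ ≤ (N + 2) * |t| := by
      calc ‖(N + 1 / 2 + t * I : ℂ)‖ ≤ ‖(N : ℂ)‖ + ‖(1 / 2 : ℂ)‖ + ‖(t : ℂ) * I‖ := norm_add₃_le
        _ = N + 1 / 2 + |t| := by simp
        _ ≤ (N + 2) * |t| := by
          have hN : (0 : ℝ) ≤ N := N.cast_nonneg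
          nlinarith
    rw [show ((N + 1 : ℕ) + 1 / 2 + t * I : ℂ) = (N + 1 / 2 + t * I) + 1 by push_cast; ring,
      Gamma_add_one _ hne, norm_mul]
    calc _ ≤ ((N + 2) * |t|) * (C * |t| ^ N * Real.exp (-(Real.pi / 2) * |t|)) := by
          gcongr
          exact h t ht
      _ = _ := by ring

/-- On each vertical strip of finite width, `f(σ + it)` is of order `|t| ^ k * exp (-θ |t|)` for
some `k`, uniformly in `σ`. -/
def VerticalDecay (f : ℂ → ℂ) (θ : ℝ) : Prop :=
  ∀ a b : ℝ, ∃ (C : ℝ) (k : ℕ) (T : ℝ), 0 ≤ C ∧ 1 ≤ T ∧ ∀ s : ℂ, s.re ∈ Icc a b → T ≤ |s.im| →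
    ‖f s‖ ≤ C * |s.im| ^ k * Real.exp (-θ * |s.im|)

theorem verticalDecay_Gamma : VerticalDecay Gamma (Real.pi / 2) := by
  intro a b
  -- Shifting by n brings the strip into the right half-plane, and N + 1/2 lies to the right of the
  -- shifted strip. Monotonicity of ‖Γ(σ + it)‖ / Γ(σ) then reduces to the single line at N + 1/2.
  obtain ⟨n, hn⟩ := exists_nat_gt (-a)
  obtain ⟨N, hN⟩ := exists_nat_gt (b + n)
  obtain ⟨C, hC, h⟩ := exists_norm_Gamma_nat_add_one_half_le N
  have hcont : ContinuousOn Real.Gamma (Icc (a + n) (b + n)) := fun x hx =>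
    (Real.differentiableAt_Gamma fun m => by
      have : (0 : ℝ) ≤ m := m.cast_nonneg
      have := hx.1
      intro h
      linarith).continuousAt.continuousWithinAt
  obtain ⟨M, hM⟩ := isCompact_Icc.exists_bound_of_continuousOn hcont
  have hΓ : 0 < Real.Gamma (N + 1 / 2) := Real.Gamma_pos_of_pos (by positivity)
  refine ⟨|M| / Real.Gamma (N + 1 / 2) * C, N, 1, by positivity, le_rfl, fun s hs ht => ?_⟩
  have hre : (s + n).re = s.re + n := by simp
  have h1 : 0 < (s + n).re := by
    rw [hre]
    linarith [hs.1]
  have hb : 0 < N + 1 / 2 - (s + n).re := by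
    rw [hre]
    linarith [hs.2]
  have h2 := norm_Gamma_le_mul_norm_Gamma_add h1 hb
  have h3 : s + n + ((N + 1 / 2 - (s + n).re : ℝ) : ℂ) = N + 1 / 2 + s.im * I := by
    apply Complex.ext <;> simp
  rw [h3, add_sub_cancel] at h2
  have h4 : Real.Gamma (s + n).re ≤ |M| := by
    rw [hre]
    exact (le_abs_self _).trans ((hM _ ⟨by linarith [hs.1], by linarith [hs.2]⟩).trans
      (le_abs_self M))
  calc ‖Gamma s‖ ≤ ‖Gamma (s + n)‖ := norm_Gamma_le_norm_Gamma_add_nat ht n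
    _ ≤ _ := h2
    _ ≤ |M| / Real.Gamma (N + 1 / 2) *
        (C * |s.im| ^ N * Real.exp (-(Real.pi / 2) * |s.im|)) := by
      gcongr
      exact h _ ht
    _ = _ := by ring

theorem norm_sin_le_exp_abs_im (z : ℂ) : ‖sin z‖ ≤ Real.exp |z.im| := by
  have h1 : ‖exp (-z * I)‖ ≤ Real.exp |z.im| := by
    rw [norm_exp]
    simpa using le_abs_self z.im
  have h2 : ‖exp (z * I)‖ ≤ Real.exp |z.im| := by
    rw [norm_exp]
    simpa using neg_le_abs z.im
  have h3 := norm_sub_le (exp (-z * I)) (exp (z * I))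
  rw [sin, norm_div, norm_mul, norm_I, mul_one, norm_ofNat, div_le_iff₀ two_pos]
  linarith

theorem VerticalDecay.mul {f g : ℂ → ℂ} {θ η : ℝ} (hf : VerticalDecay f θ)
    (hg : VerticalDecay g η) : VerticalDecay (fun s => f s * g s) (θ + η) := by
  intro a b
  obtain ⟨C, k, T, hC, hT, h⟩ := hf a b
  obtain ⟨C', k', T', hC', -, h'⟩ := hg a b
  refine ⟨C * C', k + k', max T T', by positivity, hT.trans (le_max_left _ _), fun s hs ht => ?_⟩
  calc ‖f s * g s‖ = ‖f s‖ * ‖g s‖ := norm_mul _ _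
    _ ≤ (C * |s.im| ^ k * Real.exp (-θ * |s.im|)) *
        (C' * |s.im| ^ k' * Real.exp (-η * |s.im|)) := by
      gcongr
      · exact h s hs ((le_max_left _ _).trans ht)
      · exact h' s hs ((le_max_right _ _).trans ht)
    _ = _ := by
      rw [show -(θ + η) * |s.im| = -θ * |s.im| + -η * |s.im| by ring, Real.exp_add]
      ring

theorem verticalDecay_one : VerticalDecay (fun _ => 1) 0 := fun _ _ =>
  ⟨1, 0, 1, zero_le_one, le_rfl, fun s _ _ => by simp⟩

theorem VerticalDecay.list_prod {ι : Type*} {f : ι → ℂ → ℂ} {θ : ι → ℝ} (l : List ι)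
    (h : ∀ i ∈ l, VerticalDecay (f i) (θ i)) :
    VerticalDecay (fun s => (l.map fun i => f i s).prod) (l.map θ).sum := by
  induction l with
  | nil => simpa using verticalDecay_one
  | cons i l ih =>
    simp only [List.map_cons, List.prod_cons, List.sum_cons]
    exact (h i (by simp)).mul (ih fun j hj => h j (by simp [hj]))

/-- Affine change of variable with real coefficients. -/
theorem VerticalDecay.comp_affine {f : ℂ → ℂ} {θ : ℝ} (hf : VerticalDecay f θ) (α : ℝ) {β : ℝ}
    (hβ : β ≠ 0) : VerticalDecay (fun s => f (α + β * s)) (|β| * θ) := by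
  intro a b
  obtain ⟨C, k, T, hC, hT, h⟩ := hf (min (α + β * a) (α + β * b)) (max (α + β * a) (α + β * b))
  have hβ' : 0 < |β| := abs_pos.2 hβ
  refine ⟨C * |β| ^ k, k, max 1 (T / |β|), by positivity, le_max_left _ _, fun s hs ht => ?_⟩
  have hre : (α + β * s : ℂ).re = α + β * s.re := by simp
  have him : |(α + β * s : ℂ).im| = |β| * |s.im| := by simp [abs_mul]
  have hT' : T ≤ |(α + β * s : ℂ).im| := by
    rw [him, mul_comm, ← div_le_iff₀ hβ']
    exact (le_max_right _ _).trans ht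
  refine (h _ ?_ hT').trans_eq ?_
  · rw [hre]
    rcases hβ.lt_or_gt with hb | hb
    · exact ⟨(min_le_right _ _).trans (by nlinarith [hs.2]),
        le_trans (by nlinarith [hs.1]) (le_max_left _ _)⟩
    · exact ⟨(min_le_left _ _).trans (by nlinarith [hs.1]),
        le_trans (by nlinarith [hs.2]) (le_max_right _ _)⟩
  · rw [him]
    ring_nf

theorem verticalDecay_sin_pi_mul : VerticalDecay (fun s => sin (Real.pi * s)) (-Real.pi) :=
  fun _ _ => ⟨1, 0, 1, zero_le_one, le_rfl, fun s _ _ => by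
    simpa [abs_mul, abs_of_pos Real.pi_pos] using norm_sin_le_exp_abs_im (Real.pi * s)⟩

theorem inv_Gamma_eq {s : ℂ} (hs : s.im ≠ 0) :
    (Gamma s)⁻¹ = (Real.pi : ℂ)⁻¹ * (Gamma (1 - s) * sin (Real.pi * s)) := by
  have hπ : (Real.pi : ℂ) ≠ 0 := ofReal_ne_zero.2 Real.pi_ne_zero
  have hΓ : Gamma s ≠ 0 := Gamma_ne_zero fun m h => hs (by simp [h])
  have hΓ' : Gamma (1 - s) ≠ 0 := Gamma_ne_zero fun m h => hs (by
    have := congrArg im h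
    simpa using this)
  have h := Gamma_mul_Gamma_one_sub s
  have hsin : sin (Real.pi * s) ≠ 0 := by
    intro h0
    rw [h0, div_zero] at h
    exact mul_ne_zero hΓ hΓ' h
  rw [eq_div_iff hsin] at h
  field_simp
  linear_combination -h

/-- By reflection 1/Γ(s) = Γ(1 - s) sin(πs) / π: decay rate π/2 against growth rate π. -/
theorem verticalDecay_inv_Gamma : VerticalDecay (fun s => (Gamma s)⁻¹) (-(Real.pi / 2)) := by
  intro a b
  have h1 := verticalDecay_Gamma.comp_affine 1 (β := -1) (by simp)
  obtain ⟨C, k, T, hC, hT, h⟩ := (h1.mul verticalDecay_sin_pi_mul) a b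
  refine ⟨Real.pi⁻¹ * C, k, T, by positivity, hT, fun s hs ht => ?_⟩
  have him : s.im ≠ 0 := fun h0 => by
    rw [h0, abs_zero] at ht
    linarith
  have hs' := h s hs ht
  simp only [ofReal_one, ofReal_neg, neg_mul, one_mul, ← sub_eq_add_neg] at hs'
  dsimp only
  rw [inv_Gamma_eq him, norm_mul, norm_inv, norm_real, Real.norm_of_nonneg Real.pi_pos.le]
  refine (mul_le_mul_of_nonneg_left hs' (by positivity)).trans_eq ?_
  simp only [abs_neg, abs_one]
  ring_nf

end Complex

/-! ### Kernels on a strip: contour shift and Mellin inversion -/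

namespace Complex

open Filter Topology FourierTransform

/-- `K` is holomorphic on the vertical strip over the open interval `S`, and decays exponentially
along vertical lines, uniformly on closed substrips. -/
structure IsStripKernel (K : ℂ → ℂ) (S : Set ℝ) : Prop where
  isOpen : IsOpen S
  ordConnected : S.OrdConnected
  differentiableOn : DifferentiableOn ℂ K (re ⁻¹' S)
  bound : ∀ a ∈ S, ∀ b ∈ S, ∃ C δ : ℝ, 0 < δ ∧ ∀ s : ℂ, s.re ∈ Icc a b →
    ‖K s‖ ≤ C * Real.exp (-δ * |s.im|)

/-- Half of the exponential rate absorbs the power of |Im s|, through x^k / k! ≤ exp x at x = θ|Im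
s|/2; the part of the strip with |Im s| ≤ T is compact. -/
theorem VerticalDecay.exists_bound {f : ℂ → ℂ} {θ : ℝ} (hf : VerticalDecay f θ) (hθ : 0 < θ)
    {a b : ℝ} (hc : ContinuousOn f (re ⁻¹' Icc a b)) :
    ∃ C δ : ℝ, 0 < δ ∧ ∀ s : ℂ, s.re ∈ Icc a b → ‖f s‖ ≤ C * Real.exp (-δ * |s.im|) := by
  obtain ⟨C, k, T, hC, hT, h⟩ := hf a b
  have hcomp : IsCompact (Icc a b ×ℂ Icc (-T) T) := isCompact_Icc.reProdIm isCompact_Icc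
  obtain ⟨M, hM⟩ := hcomp.exists_bound_of_continuousOn (hc.mono fun s hs => hs.1)
  set C₁ := C * ((2 / θ) ^ k * k.factorial)
  have hC₁ : 0 ≤ C₁ := by positivity
  refine ⟨C₁ + |M| * Real.exp (θ / 2 * T), θ / 2, by positivity, fun s hs => ?_⟩
  rw [add_mul]
  rcases le_total T |s.im| with ht | ht
  · have hk := Real.pow_div_factorial_le_exp (x := θ / 2 * |s.im|) (by positivity) k
    rw [div_le_iff₀ (by positivity), mul_pow] at hk
    have hk' : |s.im| ^ k ≤ (2 / θ) ^ k * k.factorial * Real.exp (θ / 2 * |s.im|) := by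
      calc |s.im| ^ k = (2 / θ) ^ k * ((θ / 2) ^ k * |s.im| ^ k) := by
            rw [← mul_assoc, ← mul_pow, div_mul_div_cancel₀' two_ne_zero, div_self hθ.ne', one_pow,
              one_mul]
        _ ≤ (2 / θ) ^ k * (Real.exp (θ / 2 * |s.im|) * k.factorial) := by gcongr
        _ = _ := by ring
    calc ‖f s‖ ≤ C * |s.im| ^ k * Real.exp (-θ * |s.im|) := h s hs ht
      _ ≤ C * ((2 / θ) ^ k * k.factorial * Real.exp (θ / 2 * |s.im|)) *
          Real.exp (-θ * |s.im|) := by gcongr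
      _ = C₁ * (Real.exp (θ / 2 * |s.im|) * Real.exp (-θ * |s.im|)) := by ring
      _ = C₁ * Real.exp (-(θ / 2) * |s.im|) := by
        rw [← Real.exp_add]
        ring_nf
      _ ≤ _ := le_add_of_nonneg_right (by positivity)
  · have h1 : 1 ≤ Real.exp (θ / 2 * T) * Real.exp (-(θ / 2) * |s.im|) := by
      rw [← Real.exp_add, Real.one_le_exp_iff]
      nlinarith
    calc ‖f s‖ ≤ |M| := (hM s ⟨hs, abs_le.1 ht⟩).trans (le_abs_self M)
      _ ≤ |M| * (Real.exp (θ / 2 * T) * Real.exp (-(θ / 2) * |s.im|)) :=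
        le_mul_of_one_le_right (abs_nonneg _) h1
      _ = |M| * Real.exp (θ / 2 * T) * Real.exp (-(θ / 2) * |s.im|) := by ring
      _ ≤ _ := le_add_of_nonneg_left (by positivity)

theorem VerticalDecay.isStripKernel {K : ℂ → ℂ} {θ : ℝ} (hK : VerticalDecay K θ) (hθ : 0 < θ)
    {S : Set ℝ} (hS : IsOpen S) (hS' : S.OrdConnected)
    (hd : DifferentiableOn ℂ K (re ⁻¹' S)) : IsStripKernel K S where
  isOpen := hS
  ordConnected := hS'
  differentiableOn := hd
  bound _ ha _ hb := hK.exists_bound hθ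
    (hd.continuousOn.mono fun _ hs => hS'.out ha hb hs)

theorem integrable_exp_neg_mul_abs {δ : ℝ} (hδ : 0 < δ) :
    Integrable fun y : ℝ => Real.exp (-δ * |y|) := by
  have h1 : IntegrableOn (fun y : ℝ => Real.exp (-δ * |y|)) (Ioi 0) :=
    (integrableOn_exp_mul_Ioi (neg_lt_zero.2 hδ) 0).congr_fun
      (fun y hy => by simp only [abs_of_pos (mem_Ioi.1 hy)]) measurableSet_Ioi
  have h2 : IntegrableOn (fun y : ℝ => Real.exp (-δ * |y|)) (Iic 0) :=
    (integrableOn_exp_mul_Iic hδ 0).congr_fun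
      (fun y hy => by simp only [abs_of_nonpos (mem_Iic.1 hy), mul_neg, neg_mul, neg_neg])
      measurableSet_Iic
  rw [← integrableOn_univ, ← Iic_union_Ioi (a := (0 : ℝ))]
  exact h2.union h1

namespace IsStripKernel

variable {K : ℂ → ℂ} {S : Set ℝ}

theorem continuous_vertical (hK : IsStripKernel K S) {c : ℝ} (hc : c ∈ S) :
    Continuous fun y : ℝ => K (c + y * I) :=
  hK.differentiableOn.continuousOn.comp_continuous (by fun_prop) fun y => by simpa using hc

theorem integrable_vertical (hK : IsStripKernel K S) {c : ℝ} (hc : c ∈ S) :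
    Integrable fun y : ℝ => K (c + y * I) := by
  obtain ⟨C, δ, hδ, h⟩ := hK.bound c hc c hc
  refine ((integrable_exp_neg_mul_abs hδ).const_mul C).mono'
    (hK.continuous_vertical hc).aestronglyMeasurable (ae_of_all _ fun y => ?_)
  simpa using h (c + y * I) (by simp)

/-- On a vertical line |x^(-s)| is constant, so the full Mellin-Barnes integrand is again a strip
kernel and its contour can be shifted. -/
theorem cpow_mul (hK : IsStripKernel K S) {x : ℝ} (hx : 0 < x) :
    IsStripKernel (fun s => (x : ℂ) ^ (-s) * K s) S where
  isOpen := hK.isOpen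
  ordConnected := hK.ordConnected
  differentiableOn := by
    have hx0 : (x : ℂ) ≠ 0 := ofReal_ne_zero.2 hx.ne'
    have h : Differentiable ℂ fun s : ℂ => (x : ℂ) ^ (-s) := fun s =>
      differentiableAt_id.neg.const_cpow (Or.inl hx0)
    exact h.differentiableOn.mul hK.differentiableOn
  bound a ha b hb := by
    obtain ⟨C, δ, hδ, h⟩ := hK.bound a ha b hb
    have hcont : Continuous fun σ : ℝ => x ^ (-σ) :=
      Real.continuous_const_rpow hx.ne' |>.comp continuous_neg
    obtain ⟨M, hM⟩ := isCompact_Icc.exists_bound_of_continuousOn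
      (hcont.continuousOn (s := Icc a b))
    refine ⟨M * C, δ, hδ, fun s hs => ?_⟩
    have hM' := hM _ hs
    rw [Real.norm_of_nonneg (by positivity)] at hM'
    rw [norm_mul, norm_cpow_eq_rpow_re_of_pos hx, neg_re, mul_assoc]
    exact mul_le_mul hM' (h s hs) (norm_nonneg _) ((Real.rpow_nonneg hx.le _).trans hM')

theorem tendsto_integral_horizontal (hK : IsStripKernel K S) {a b : ℝ} (ha : a ∈ S) (hb : b ∈ S)
    (hab : a ≤ b) {ε : ℝ} (hε : |ε| = 1) :
    Tendsto (fun T : ℝ => ∫ x in a..b, K (x + (ε * T : ℝ) * I)) atTop (𝓝 0) := by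
  obtain ⟨C, δ, hδ, h⟩ := hK.bound a ha b hb
  have h0 : Tendsto (fun T : ℝ => C * Real.exp (-δ * T) * |b - a|) atTop (𝓝 0) := by
    have h1 : Tendsto (fun T : ℝ => -δ * T) atTop atBot :=
      tendsto_id.const_mul_atTop_of_neg (neg_lt_zero.2 hδ)
    simpa using ((Real.tendsto_exp_atBot.comp h1).const_mul C).mul_const |b - a|
  refine squeeze_zero_norm' ?_ h0
  filter_upwards [eventually_ge_atTop 0] with T hT
  refine intervalIntegral.norm_integral_le_of_norm_le_const fun x hx => ?_
  rw [uIoc_of_le hab] at hx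
  have h2 := h (x + (ε * T : ℝ) * I) (by simpa using ⟨hx.1.le, hx.2⟩)
  have him : ((x : ℂ) + (ε * T : ℝ) * I).im = ε * T := by simp
  rwa [him, abs_mul, hε, one_mul, abs_of_nonneg hT] at h2

theorem integral_vertical_eq_of_le (hK : IsStripKernel K S) {a b : ℝ} (ha : a ∈ S) (hb : b ∈ S)
    (hab : a ≤ b) : ∫ y : ℝ, K (a + y * I) = ∫ y : ℝ, K (b + y * I) := by
  have hA := intervalIntegral_tendsto_integral (hK.integrable_vertical ha)
    tendsto_neg_atTop_atBot tendsto_id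
  have hB := intervalIntegral_tendsto_integral (hK.integrable_vertical hb)
    tendsto_neg_atTop_atBot tendsto_id
  have h1 := hK.tendsto_integral_horizontal ha hb hab (ε := -1) (by simp)
  have h2 := hK.tendsto_integral_horizontal ha hb hab (ε := 1) (by simp)
  -- Cauchy's theorem on the rectangle of height 2T; its horizontal sides vanish as T → ∞.
  have h3 := ((h1.sub h2).add (hB.const_smul I)).sub (hA.const_smul I)
  have h4 : ∀ T : ℝ, (∫ x in a..b, K (x + (-1 * T : ℝ) * I)) -
      (∫ x in a..b, K (x + (1 * T : ℝ) * I)) + I • (∫ y in -T..id T, K (b + y * I)) -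
      I • (∫ y in -T..id T, K (a + y * I)) = 0 := by
    intro T
    have := integral_boundary_rect_eq_zero_of_differentiableOn K (a + (-T : ℝ) * I) (b + T * I)
      (hK.differentiableOn.mono fun s hs => by
        have := hs.1
        simp only [mem_preimage, add_re, ofReal_re, mul_re, I_re, mul_zero, ofReal_im, I_im,
          mul_one, sub_zero, add_zero, uIcc_of_le hab] at this
        exact hK.ordConnected.out ha hb this)
    simpa using this
  have h5 := tendsto_nhds_unique h3 ((tendsto_const_nhds (x := (0 : ℂ))).congr fun T => (h4 T).symm)
  have h6 : I * ((∫ y : ℝ, K (b + y * I)) - ∫ y : ℝ, K (a + y * I)) = 0 := by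
    rw [← h5]
    simp only [smul_eq_mul]
    ring
  rcases mul_eq_zero.1 h6 with h7 | h7
  · exact absurd h7 I_ne_zero
  · exact (sub_eq_zero.1 h7).symm

theorem integral_vertical_eq (hK : IsStripKernel K S) {a b : ℝ} (ha : a ∈ S) (hb : b ∈ S) :
    ∫ y : ℝ, K (a + y * I) = ∫ y : ℝ, K (b + y * I) := by
  rcases le_total a b with h | h
  · exact hK.integral_vertical_eq_of_le ha hb h
  · exact (hK.integral_vertical_eq_of_le hb ha h).symm

/-- The inverse Mellin transform does not depend on the vertical line in the strip. -/
theorem mellinInv_eq (hK : IsStripKernel K S) {a b : ℝ} (ha : a ∈ S) (hb : b ∈ S) {x : ℝ}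
    (hx : 0 < x) : mellinInv a K x = mellinInv b K x := by
  have := (hK.cpow_mul hx).integral_vertical_eq ha hb
  simp only [mellinInv, smul_eq_mul, this]

/-- Moving the line from c to a replaces the factor x^(-c) by x^(-a). Choosing a on either side of a
given abscissa controls both x → 0 and x → ∞. -/
theorem exists_norm_mellinInv_le (hK : IsStripKernel K S) {a c : ℝ} (ha : a ∈ S) (hc : c ∈ S) :
    ∃ M : ℝ, 0 ≤ M ∧ ∀ x : ℝ, 0 < x → ‖mellinInv c K x‖ ≤ M * x ^ (-a) := by
  refine ⟨1 / (2 * Real.pi) * ∫ y : ℝ, ‖K (a + y * I)‖, by positivity, fun x hx => ?_⟩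
  rw [hK.mellinInv_eq hc ha hx, mellinInv, norm_smul, Real.norm_of_nonneg (by positivity),
    mul_assoc]
  gcongr
  refine (norm_integral_le_integral_norm _).trans_eq ?_
  rw [← integral_mul_const]
  congr 1 with y
  rw [norm_smul, norm_cpow_eq_rpow_re_of_pos hx, mul_comm]
  simp

theorem integrable_vertical_two_pi (hK : IsStripKernel K S) {c : ℝ} (hc : c ∈ S) :
    Integrable fun y : ℝ => K (c + 2 * Real.pi * y * I) := by
  have h := (hK.integrable_vertical hc).comp_mul_left' (R := 2 * Real.pi) (by positivity)
  simpa using h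

theorem continuous_fourierInv {f : ℝ → ℂ} (hf : Integrable f) : Continuous (𝓕⁻ f) := by
  rw [Real.fourierInv_eq_fourier_comp_neg]
  exact VectorFourier.fourierIntegral_continuous Real.continuous_fourierChar
    (L := innerₗ ℝ) continuous_inner hf.comp_neg

theorem continuousOn_mellinInv (hK : IsStripKernel K S) {c : ℝ} (hc : c ∈ S) :
    ContinuousOn (mellinInv c K) (Ioi 0) := by
  have h := continuous_fourierInv (hK.integrable_vertical_two_pi hc)
  have h1 : ContinuousOn (fun x : ℝ => (x : ℂ) ^ (-c : ℂ) •
      𝓕⁻ (fun y : ℝ => K (c + 2 * Real.pi * y * I)) (-Real.log x)) (Ioi 0) := by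
    have h0 : ContinuousOn (fun x : ℝ => (x : ℂ) ^ (-c : ℂ)) (Ioi 0) := fun x hx =>
      (continuousAt_ofReal_cpow_const x (-c) (Or.inr (ne_of_gt hx))).continuousWithinAt
    exact h0.smul <| h.comp_continuousOn (Real.continuousOn_log.mono fun x hx => ne_of_gt hx).neg
  exact h1.congr fun x hx => mellinInv_eq_fourierInv c K hx

theorem exists_mem_lt (hK : IsStripKernel K S) {c : ℝ} (hc : c ∈ S) : ∃ a ∈ S, a < c := by
  obtain ⟨ε, hε, h⟩ := Metric.isOpen_iff.1 hK.isOpen c hc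
  exact ⟨c - ε / 2, h (by simp [abs_of_pos hε]; linarith), by linarith⟩

theorem exists_mem_gt (hK : IsStripKernel K S) {c : ℝ} (hc : c ∈ S) : ∃ a ∈ S, c < a := by
  obtain ⟨ε, hε, h⟩ := Metric.isOpen_iff.1 hK.isOpen c hc
  exact ⟨c + ε / 2, h (by simp [abs_of_pos hε]; linarith), by linarith⟩

theorem mellinConvergent_mellinInv (hK : IsStripKernel K S) {c : ℝ} (hc : c ∈ S) {s : ℂ}
    (hs : s.re ∈ S) : MellinConvergent (mellinInv c K) s := by
  obtain ⟨a, ha, has⟩ := hK.exists_mem_gt hs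
  obtain ⟨b, hb, hbs⟩ := hK.exists_mem_lt hs
  have key : ∀ a ∈ S, ∃ M : ℝ, ∀ x : ℝ, 0 < x → ‖mellinInv c K x‖ ≤ M * ‖x ^ (-a)‖ := by
    intro a ha
    obtain ⟨M, -, hM⟩ := hK.exists_norm_mellinInv_le ha hc
    refine ⟨M, fun x hx => ?_⟩
    rw [Real.norm_of_nonneg (by positivity)]
    exact hM x hx
  obtain ⟨M, hM⟩ := key a ha
  obtain ⟨M', hM'⟩ := key b hb
  refine mellinConvergent_of_isBigO_rpow
    ((hK.continuousOn_mellinInv hc).locallyIntegrableOn measurableSet_Ioi)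
    (Asymptotics.IsBigO.of_bound M ?_) has (Asymptotics.IsBigO.of_bound M' ?_) hbs
  · filter_upwards [eventually_gt_atTop 0] with x hx using hM x hx
  · filter_upwards [self_mem_nhdsWithin] with x hx using hM' x hx

/-- The substitution x = exp(-u) turns Mellin inversion into Fourier inversion on the real line. -/
theorem fourierInv_eq_mellinInv {c : ℝ} (u : ℝ) :
    𝓕⁻ (fun y : ℝ => K (c + 2 * Real.pi * y * I)) u =
      Real.exp (-c * u) • mellinInv c K (Real.exp (-u)) := by
  have h := mellinInv_eq_fourierInv c K (Real.exp_pos (-u))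
  rw [h, Real.log_exp, neg_neg, real_smul, smul_eq_mul, ← mul_assoc, ← ofReal_neg,
    ← ofReal_cpow (Real.exp_pos _).le, ← Real.exp_mul, ← ofReal_mul, ← Real.exp_add,
    show -c * u + -u * -c = 0 by ring, Real.exp_zero, ofReal_one, one_mul]

theorem integrable_fourierInv (hK : IsStripKernel K S) {c : ℝ} (hc : c ∈ S) :
    Integrable (𝓕⁻ fun y : ℝ => K (c + 2 * Real.pi * y * I)) := by
  obtain ⟨a, ha, hac⟩ := hK.exists_mem_gt hc
  obtain ⟨b, hb, hbc⟩ := hK.exists_mem_lt hc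
  obtain ⟨M, hM0, hM⟩ := hK.exists_norm_mellinInv_le ha hc
  obtain ⟨M', hM0', hM'⟩ := hK.exists_norm_mellinInv_le hb hc
  have hcont := continuous_fourierInv (hK.integrable_vertical_two_pi hc)
  -- A line d > c gives decay as u → -∞, and a line d < c gives decay as u → +∞.
  have key : ∀ d N u : ℝ, ‖mellinInv c K (Real.exp (-u))‖ ≤ N * Real.exp (-u) ^ (-d) →
      ‖𝓕⁻ (fun y : ℝ => K (c + 2 * Real.pi * y * I)) u‖ ≤ N * Real.exp ((d - c) * u) := by
    intro d N u h
    rw [fourierInv_eq_mellinInv, norm_smul, Real.norm_of_nonneg (Real.exp_pos _).le]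
    calc _ ≤ Real.exp (-c * u) * (N * Real.exp (-u) ^ (-d)) := by gcongr
      _ = N * (Real.exp (-c * u) * Real.exp (-u) ^ (-d)) := by ring
      _ = _ := by
        rw [← Real.exp_mul, ← Real.exp_add]
        ring_nf
  rw [← integrableOn_univ, ← Iic_union_Ioi (a := (0 : ℝ))]
  refine IntegrableOn.union ?_ ?_
  · exact ((integrableOn_exp_mul_Iic (sub_pos.2 hac) 0).const_mul M).mono'
      hcont.aestronglyMeasurable (ae_of_all _ fun u => key a M u (hM _ (Real.exp_pos _)))
  · exact ((integrableOn_exp_mul_Ioi (sub_neg.2 hbc) 0).const_mul M').mono'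
      hcont.aestronglyMeasurable (ae_of_all _ fun u => key b M' u (hM' _ (Real.exp_pos _)))

/-- Mellin inversion: the Mellin transform of the inverse Mellin transform of `K` is `K`. -/
theorem mellin_mellinInv (hK : IsStripKernel K S) {c : ℝ} (hc : c ∈ S) {s : ℂ} (hs : s.re ∈ S) :
    mellin (mellinInv c K) s = K s := by
  -- The line is moved through s itself, so that Fourier inversion evaluates K at s.
  have h1 : mellin (mellinInv c K) s = mellin (mellinInv s.re K) s :=
    setIntegral_congr_fun measurableSet_Ioi fun x hx => by
      simp only [hK.mellinInv_eq hc hs (mem_Ioi.1 hx)]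
  have hcont : Continuous fun y : ℝ => K (s.re + 2 * Real.pi * y * I) := by
    have := (hK.continuous_vertical hs).comp (continuous_const_mul (2 * Real.pi))
    simpa [Function.comp_def] using this
  have hint : Integrable (𝓕 fun y : ℝ => K (s.re + 2 * Real.pi * y * I)) := by
    have := (hK.integrable_fourierInv hs).comp_neg
    simpa only [Real.fourierInv_eq_fourier_neg, neg_neg] using this
  have h2 : (fun u : ℝ => Real.exp (-s.re * u) • mellinInv s.re K (Real.exp (-u))) =
      𝓕⁻ fun y : ℝ => K (s.re + 2 * Real.pi * y * I) :=
    funext fun u => (fourierInv_eq_mellinInv u).symm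
  rw [h1, mellin_eq_fourier, h2,
    hcont.fourier_fourierInv_eq (hK.integrable_vertical_two_pi hs) hint]
  have hπ : (Real.pi : ℂ) ≠ 0 := ofReal_ne_zero.2 Real.pi_ne_zero
  push_cast
  rw [mul_div_cancel₀ _ (mul_ne_zero two_ne_zero hπ), re_add_im]

end IsStripKernel

end Complex

/-! ### Parseval formula -/

namespace Complex

theorem mul_rpow_cpow_neg {x τ : ℝ} (hx : 0 < x) (hτ : 0 < τ) (μ c y : ℝ) :
    ((x * τ ^ μ : ℝ) : ℂ) ^ (-(c + y * I)) =
      (x : ℂ) ^ (-(c + y * I)) * ((τ : ℂ) ^ (-(μ * c) : ℂ) *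
        exp (((-(μ * y * Real.log τ) : ℝ) : ℂ) * I)) := by
  have hτ0 : (τ : ℂ) ≠ 0 := ofReal_ne_zero.2 hτ.ne'
  rw [ofReal_mul, mul_cpow_ofReal_nonneg hx.le (by positivity), cpow_def_of_ne_zero hτ0,
    ← exp_add, cpow_def_of_ne_zero (ofReal_ne_zero.2 (Real.rpow_pos_of_pos hτ μ).ne'),
    ← ofReal_log (Real.rpow_pos_of_pos hτ μ).le, Real.log_rpow hτ, ← ofReal_log hτ.le]
  push_cast
  ring_nf

namespace IsStripKernel

/-- Parseval formula for inverse Mellin transforms. -/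
theorem hasMellin_mul {K L : ℂ → ℂ} {S T : Set ℝ} (hK : IsStripKernel K S)
    (hL : IsStripKernel L T) {c d ω μ : ℝ} (hc : c ∈ S) (hd : d ∈ T) (hω : ω - μ * c ∈ T)
    {x z : ℝ} (hx : 0 < x) (hz : 0 < z) :
    HasMellin (fun τ : ℝ => mellinInv c K (x * τ ^ μ) * mellinInv d L (z * τ)) (ω : ℂ)
      (((z ^ (-ω) : ℝ) : ℂ) *
        mellinInv c (fun s => K s * L (ω - μ * s)) (x * z ^ (-μ))) := by
  set G : ℝ → ℂ := fun τ => mellinInv d L (z * τ) with hG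
  have hre (y : ℝ) : ((ω : ℂ) - μ * (c + y * I)).re ∈ T := by simpa using hω
  have hconv {w : ℂ} (hw : w.re ∈ T) : MellinConvergent G w :=
    (MellinConvergent.comp_mul_left hz).2 (hL.mellinConvergent_mellinInv hd hw)
  have hmel {w : ℂ} (hw : w.re ∈ T) : mellin G w = (z : ℂ) ^ (-w) * L w := by
    rw [hG, mellin_comp_mul_left _ _ hz, hL.mellin_mellinInv hd hw, smul_eq_mul]
  set φ : ℝ → ℂ := fun τ => (τ : ℂ) ^ ((ω : ℂ) - μ * c - 1) * G τ with hφ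
  set ψ : ℝ → ℂ := fun y => (x : ℂ) ^ (-(c + y * I)) * K (c + y * I) with hψ
  set E : ℝ → ℝ → ℂ := fun τ y => exp (((-(μ * y * Real.log τ) : ℝ) : ℂ) * I) with hE
  have hφi : Integrable φ (volume.restrict (Ioi 0)) := by
    have := hconv (w := (ω : ℂ) - μ * c) (by simpa using hre 0)
    simpa [MellinConvergent, IntegrableOn] using this
  have hψi : Integrable ψ := (hK.cpow_mul hx).integrable_vertical hc
  -- Fubini applies because τ and y are coupled only through the unimodular factor E; φ and ψ are
  -- integrable separately, φ because ω - μc lies in T.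
  have hint : Integrable (Function.uncurry fun τ y => E τ y * (φ τ * ψ y))
      ((volume.restrict (Ioi 0)).prod volume) := by
    refine (hφi.mul_prod hψi).bdd_mul (c := 1) ?_ (ae_of_all _ fun p => ?_)
    · refine Measurable.aestronglyMeasurable ?_
      simp only [hE]
      fun_prop
    · exact (norm_exp_ofReal_mul_I _).le
  have hpt : ∀ τ ∈ Ioi (0 : ℝ), (τ : ℂ) ^ ((ω : ℂ) - 1) • (mellinInv c K (x * τ ^ μ) * G τ) =
      (1 / (2 * Real.pi)) • ∫ y : ℝ, E τ y * (φ τ * ψ y) := by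
    intro τ hτ
    have hτ0 : (τ : ℂ) ≠ 0 := ofReal_ne_zero.2 (ne_of_gt hτ)
    rw [mellinInv, smul_mul_assoc, smul_comm, smul_eq_mul, ← integral_mul_const,
      ← integral_const_mul]
    congr 2 with y
    rw [mul_rpow_cpow_neg hx hτ, smul_eq_mul, hφ, hψ, hE]
    dsimp only
    rw [show (ω : ℂ) - μ * c - 1 = (ω - 1) + -(μ * c) by ring, cpow_add _ _ hτ0]
    ring
  -- E supplies the missing imaginary part of the exponent of τ, so the inner integral is a Mellin
  -- transform on the line Re = ω - μc.
  have hinner (y : ℝ) : ∫ τ in Ioi (0 : ℝ), E τ y * (φ τ * ψ y) =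
      ψ y * mellin G (ω - μ * (c + y * I)) := by
    rw [mellin, ← integral_const_mul]
    refine setIntegral_congr_fun measurableSet_Ioi fun τ hτ => ?_
    have hτ0 : (τ : ℂ) ≠ 0 := ofReal_ne_zero.2 (ne_of_gt hτ)
    have hEc : E τ y = (τ : ℂ) ^ (-(μ * (y * I)) : ℂ) := by
      rw [hE, cpow_def_of_ne_zero hτ0, ← ofReal_log (le_of_lt hτ)]
      push_cast
      ring_nf
    simp only [hφ, hEc, smul_eq_mul]
    rw [show (ω : ℂ) - μ * (c + y * I) - 1 = -(μ * (y * I)) + (ω - μ * c - 1) by ring,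
      cpow_add _ _ hτ0]
    ring
  refine ⟨?_, ?_⟩
  · have := (hint.integral_prod_left).smul (1 / (2 * Real.pi))
    exact IntegrableOn.congr_fun this (fun τ hτ => (hpt τ hτ).symm) measurableSet_Ioi
  · rw [mellin, setIntegral_congr_fun measurableSet_Ioi hpt, integral_smul,
      integral_integral_swap hint, mellinInv, mul_smul_comm, ← integral_const_mul]
    congr 2 with y
    have hz0 : (z : ℂ) ≠ 0 := ofReal_ne_zero.2 hz.ne'
    rw [hinner, hmel (hre y), hψ, ofReal_mul, mul_cpow_ofReal_nonneg hx.le (by positivity),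
      cpow_def_of_ne_zero (ofReal_ne_zero.2 (Real.rpow_pos_of_pos hz (-μ)).ne'),
      ← ofReal_log (Real.rpow_pos_of_pos hz (-μ)).le, Real.log_rpow hz, Real.rpow_def_of_pos hz,
      ofReal_exp, cpow_def_of_ne_zero hz0 (-(_ - _)), ← ofReal_log hz.le]
    have hexp : exp (Real.log z * -(ω - μ * (c + y * I))) =
        exp ((Real.log z * -ω : ℝ)) * exp ((-μ * Real.log z : ℝ) * -(c + y * I)) := by
      rw [← exp_add]
      push_cast
      ring_nf
    rw [hexp, smul_eq_mul]
    ring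

end IsStripKernel

end Complex

/-! ### Auxiliary facts on lists and Gamma -/

theorem EReal.lt_iInf_mem_list_iff {ι : Type*} (l : List ι) (f : ι → EReal) {c : EReal}
    (hc : c < ⊤) : c < ⨅ i ∈ l, f i ↔ ∀ i ∈ l, c < f i := by
  classical
  have h : ⨅ i ∈ l, f i = l.toFinset.inf f := by simp [Finset.inf_eq_iInf]
  rw [h, Finset.lt_inf_iff hc]
  simp

theorem List.take_insert {α : Type*} {l l' : List α} {n k : ℕ} (hn : n ≤ l.length)
    (hk : k ≤ l'.length) :
    (l.take n ++ l' ++ l.drop n).take (n + k) = l.take n ++ l'.take k := by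
  rw [List.append_assoc, List.take_append, List.take_append]
  simp [hn, hk, List.take_take]

theorem List.drop_insert {α : Type*} {l l' : List α} {n k : ℕ} (hn : n ≤ l.length)
    (hk : k ≤ l'.length) :
    (l.take n ++ l' ++ l.drop n).drop (n + k) = l'.drop k ++ l.drop n := by
  rw [List.append_assoc, List.drop_append, List.drop_append]
  simp [hn, hk]

theorem DifferentiableOn.list_prod_map {ι : Type*} {f : ι → ℂ → ℂ} {U : Set ℂ} (l : List ι)
    (h : ∀ i ∈ l, DifferentiableOn ℂ (f i) U) :
    DifferentiableOn ℂ (fun s => (l.map fun i => f i s).prod) U := by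
  induction l with
  | nil => simp
  | cons i l ih =>
    simp only [List.map_cons, List.prod_cons]
    exact (h i (by simp)).mul (ih fun j hj => h j (by simp [hj]))

theorem Complex.differentiableAt_Gamma_of_re_pos {s : ℂ} (hs : 0 < s.re) :
    DifferentiableAt ℂ Gamma s :=
  differentiableAt_Gamma s fun m h => by
    have : (0 : ℝ) ≤ m := m.cast_nonneg
    rw [h] at hs
    simp at hs
    linarith

/-! ### The Fox kernel as a strip kernel -/

namespace FoxData

/-- The abscissas `c` such that the line `Re s = c` separates the poles of the two families of
Gamma factors in the numerator. -/
def strip (F : FoxData) : Set ℝ :=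
  {c | (∀ y ∈ F.b.take F.m, 0 < y.1 + y.2 * c) ∧ ∀ x ∈ F.a.take F.n, 0 < 1 - x.1 - x.2 * c}

variable {F : FoxData}

theorem lower_lt_iff (hb : ∀ y ∈ F.b, 0 < y.2) (c : ℝ) :
    F.lower < (c : EReal) ↔ ∀ y ∈ F.b.take F.m, 0 < y.1 + y.2 * c := by
  rw [lower, EReal.neg_lt_comm, ← EReal.coe_neg, EReal.lt_iInf_mem_list_iff _ _ (EReal.coe_lt_top _)]
  refine forall₂_congr fun y hy => ?_
  rw [EReal.coe_lt_coe_iff, lt_div_iff₀ (hb y (List.mem_of_mem_take hy))]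
  constructor <;> intro h <;> linarith

theorem lt_upper_iff (ha : ∀ x ∈ F.a, 0 < x.2) (c : ℝ) :
    (c : EReal) < F.upper ↔ ∀ x ∈ F.a.take F.n, 0 < 1 - x.1 - x.2 * c := by
  rw [upper, EReal.lt_iInf_mem_list_iff _ _ (EReal.coe_lt_top _)]
  refine forall₂_congr fun x hx => ?_
  rw [EReal.coe_lt_coe_iff, lt_div_iff₀ (ha x (List.mem_of_mem_take hx))]
  constructor <;> intro h <;> linarith

theorem mem_strip_iff (ha : ∀ x ∈ F.a, 0 < x.2) (hb : ∀ y ∈ F.b, 0 < y.2) {c : ℝ} :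
    c ∈ F.strip ↔ F.lower < (c : EReal) ∧ (c : EReal) < F.upper := by
  rw [lower_lt_iff hb, lt_upper_iff ha]
  rfl

theorem isOpen_strip (F : FoxData) : IsOpen F.strip := by
  have h1 : F.strip = (⋂ y ∈ {y | y ∈ F.b.take F.m}, {c : ℝ | 0 < y.1 + y.2 * c}) ∩
      ⋂ x ∈ {x | x ∈ F.a.take F.n}, {c : ℝ | 0 < 1 - x.1 - x.2 * c} := by
    ext c
    simp [strip]
  rw [h1]
  exact ((List.finite_toSet _).isOpen_biInter fun y _ => isOpen_lt (by fun_prop) (by fun_prop)).inter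
    ((List.finite_toSet _).isOpen_biInter fun x _ => isOpen_lt (by fun_prop) (by fun_prop))

theorem ordConnected_strip (ha : ∀ x ∈ F.a, 0 < x.2) (hb : ∀ y ∈ F.b, 0 < y.2) :
    F.strip.OrdConnected := by
  refine ⟨fun c hc d hd e he => ⟨fun y hy => ?_, fun x hx => ?_⟩⟩
  · have h1 := hc.1 y hy
    have h2 := mul_le_mul_of_nonneg_left he.1 (hb y (List.mem_of_mem_take hy)).le
    linarith
  · have h1 := hd.2 x hx
    have h2 := mul_le_mul_of_nonneg_left he.2 (ha x (List.mem_of_mem_take hx)).le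
    linarith

theorem kernel_eq_mul (F : FoxData) (s : ℂ) : F.kernel s =
    ((F.b.take F.m).map fun y => Complex.Gamma ((y.1 : ℂ) + (y.2 : ℂ) * s)).prod *
    ((F.a.take F.n).map fun x => Complex.Gamma (1 - (x.1 : ℂ) - (x.2 : ℂ) * s)).prod *
    (((F.b.drop F.m).map fun y => (Complex.Gamma (1 - (y.1 : ℂ) - (y.2 : ℂ) * s))⁻¹).prod *
    ((F.a.drop F.n).map fun x => (Complex.Gamma ((x.1 : ℂ) + (x.2 : ℂ) * s))⁻¹).prod) := by
  rw [kernel, div_eq_mul_inv, mul_inv, List.prod_inv, List.prod_inv, List.map_map, List.map_map]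
  rfl

/-- On the strip the numerator Gamma factors have arguments of positive real part, and 1/Γ is
entire, so the denominator imposes no condition. -/
theorem differentiableOn_kernel (F : FoxData) :
    DifferentiableOn ℂ F.kernel (Complex.re ⁻¹' F.strip) := by
  rw [funext F.kernel_eq_mul]
  refine ((DifferentiableOn.list_prod_map _ fun y hy => ?_).mul
    (DifferentiableOn.list_prod_map _ fun x hx => ?_)).mul
    ((DifferentiableOn.list_prod_map _ fun y hy => ?_).mul
      (DifferentiableOn.list_prod_map _ fun x hx => ?_))
  · intro s hs
    have h : 0 < ((y.1 : ℂ) + (y.2 : ℂ) * s).re := by simpa using hs.1 y hy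
    exact ((Complex.differentiableAt_Gamma_of_re_pos h).comp s
      (f := fun s : ℂ => (y.1 : ℂ) + (y.2 : ℂ) * s) (by fun_prop)).differentiableWithinAt
  · intro s hs
    have h : 0 < (1 - (x.1 : ℂ) - (x.2 : ℂ) * s).re := by simpa using hs.2 x hx
    exact ((Complex.differentiableAt_Gamma_of_re_pos h).comp s
      (f := fun s : ℂ => 1 - (x.1 : ℂ) - (x.2 : ℂ) * s) (by fun_prop)).differentiableWithinAt
  · exact (Complex.differentiable_one_div_Gamma.comp
      (f := fun s : ℂ => 1 - (y.1 : ℂ) - (y.2 : ℂ) * s) (by fun_prop)).differentiableOn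
  · exact (Complex.differentiable_one_div_Gamma.comp
      (f := fun s : ℂ => (x.1 : ℂ) + (x.2 : ℂ) * s) (by fun_prop)).differentiableOn

theorem verticalDecay_comp_add {f : ℂ → ℂ} {θ : ℝ} (hf : Complex.VerticalDecay f θ) (α : ℝ)
    {β : ℝ} (hβ : 0 < β) : Complex.VerticalDecay (fun s => f (α + β * s)) (β * θ) := by
  simpa [abs_of_pos hβ] using hf.comp_affine α hβ.ne'

theorem verticalDecay_comp_sub {f : ℂ → ℂ} {θ : ℝ} (hf : Complex.VerticalDecay f θ) (α : ℝ)
    {β : ℝ} (hβ : 0 < β) : Complex.VerticalDecay (fun s => f (1 - α - β * s)) (β * θ) := by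
  simpa [abs_of_pos hβ, sub_eq_add_neg] using hf.comp_affine (1 - α) (neg_ne_zero.2 hβ.ne')

theorem verticalDecay_kernel (ha : ∀ x ∈ F.a, 0 < x.2) (hb : ∀ y ∈ F.b, 0 < y.2) :
    Complex.VerticalDecay F.kernel (F.chi * (Real.pi / 2)) := by
  rw [funext F.kernel_eq_mul]
  have h1 := Complex.VerticalDecay.list_prod (F.b.take F.m) fun y hy =>
    verticalDecay_comp_add Complex.verticalDecay_Gamma y.1 (hb y (List.mem_of_mem_take hy))
  have h2 := Complex.VerticalDecay.list_prod (F.a.take F.n) fun x hx =>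
    verticalDecay_comp_sub Complex.verticalDecay_Gamma x.1 (ha x (List.mem_of_mem_take hx))
  have h3 := Complex.VerticalDecay.list_prod (F.b.drop F.m) fun y hy =>
    verticalDecay_comp_sub Complex.verticalDecay_inv_Gamma y.1 (hb y (List.mem_of_mem_drop hy))
  have h4 := Complex.VerticalDecay.list_prod (F.a.drop F.n) fun x hx =>
    verticalDecay_comp_add Complex.verticalDecay_inv_Gamma x.1 (ha x (List.mem_of_mem_drop hx))
  convert (h1.mul h2).mul (h3.mul h4) using 1
  simp only [List.sum_map_mul_right, chi]
  ring

theorem isStripKernel_kernel (ha : ∀ x ∈ F.a, 0 < x.2) (hb : ∀ y ∈ F.b, 0 < y.2)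
    (hχ : 0 < F.chi) : Complex.IsStripKernel F.kernel F.strip :=
  (verticalDecay_kernel ha hb).isStripKernel (by positivity) F.isOpen_strip
    (ordConnected_strip ha hb) F.differentiableOn_kernel

/-- The integral defining the `H`-function may be taken over any admissible line. -/
theorem foxH_eq_mellinInv (ha : ∀ x ∈ F.a, 0 < x.2) (hb : ∀ y ∈ F.b, 0 < y.2)
    (hχ : 0 < F.chi) {c : ℝ} (hc : c ∈ F.strip) {t : ℝ} (ht : 0 < t) :
    F.foxH t = mellinInv c F.kernel t := by
  have h : ∃ c : ℝ, F.lower < (c : EReal) ∧ (c : EReal) < F.upper :=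
    ⟨c, (mem_strip_iff ha hb).1 hc⟩
  rw [foxH, dif_pos h]
  exact (isStripKernel_kernel ha hb hχ).mellinInv_eq ((mem_strip_iff ha hb).2 h.choose_spec) hc ht

/-- The poles of the two families lie strictly on opposite sides of the line Re s = c. -/
theorem poles_ne_of_mem_strip (ha : ∀ x ∈ F.a, 0 < x.2) (hb : ∀ y ∈ F.b, 0 < y.2) {c : ℝ}
    (hc : c ∈ F.strip) : ∀ x ∈ F.a.take F.n, ∀ y ∈ F.b.take F.m, ∀ l l' : ℕ,
      x.2 * ((l : ℝ) + y.1) ≠ y.2 * (x.1 - (l' : ℝ) - 1) := by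
  intro x hx y hy l l' h
  have hx0 := ha x (List.mem_of_mem_take hx)
  have hy0 := hb y (List.mem_of_mem_take hy)
  have h1 := mul_pos hx0 (hc.1 y hy)
  have h2 := mul_pos hy0 (hc.2 x hx)
  have h3 : 0 ≤ x.2 * (l : ℝ) := by positivity
  have h4 : 0 ≤ y.2 * (l' : ℝ) := by positivity
  nlinarith

/-- Positivity and Mellin transform of a product of two `H`-functions, for data `P` whose kernel
is `K_F(s) K_G(ω - μ s)`. -/
theorem hasMellin_foxH_mul {G P : FoxData} (hF : F.IsAdmissible) (hG : G.IsAdmissible)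
    (hPa : ∀ x ∈ P.a, 0 < x.2) (hPb : ∀ y ∈ P.b, 0 < y.2)
    (hχF : 0 < F.chi) (hχG : 0 < G.chi) (hχP : 0 < P.chi)
    {c ω μ : ℝ} (hcF : c ∈ F.strip) (hcG : ω - μ * c ∈ G.strip) (hcP : c ∈ P.strip)
    (hP : ∀ s, P.kernel s = F.kernel s * G.kernel (ω - μ * s))
    {ξ ζ : ℝ} (hξ : 0 < ξ) (hζ : 0 < ζ) :
    HasMellin (fun τ : ℝ => F.foxH (ξ * τ ^ μ) * G.foxH (ζ * τ)) (ω : ℂ)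
      (((ζ ^ (-ω) : ℝ) : ℂ) * P.foxH (ξ * ζ ^ (-μ))) := by
  have h := (isStripKernel_kernel hF.a_pos hF.b_pos hχF).hasMellin_mul
    (isStripKernel_kernel hG.a_pos hG.b_pos hχG) hcF hcG hcG hξ hζ
  rw [← funext hP, ← foxH_eq_mellinInv hPa hPb hχP hcP (by positivity)] at h
  have heq : EqOn
      (fun τ : ℝ => (τ : ℂ) ^ ((ω : ℂ) - 1) • (F.foxH (ξ * τ ^ μ) * G.foxH (ζ * τ)))
      (fun τ : ℝ => (τ : ℂ) ^ ((ω : ℂ) - 1) • (mellinInv c F.kernel (ξ * τ ^ μ) *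
        mellinInv (ω - μ * c) G.kernel (ζ * τ))) (Ioi 0) := fun τ hτ => by
    have hτ' : 0 < τ := hτ
    simp only [foxH_eq_mellinInv hF.a_pos hF.b_pos hχF hcF (by positivity : 0 < ξ * τ ^ μ),
      foxH_eq_mellinInv hG.a_pos hG.b_pos hχG hcG (by positivity : 0 < ζ * τ)]
  exact ⟨h.1.congr_fun heq.symm measurableSet_Ioi,
    (setIntegral_congr_fun measurableSet_Ioi heq).trans h.2⟩

/-- The value is the integral of a strictly positive integrable function. The factor `1 * τ` is the
case ζ = 1, where the prefactor ζ^(-ω) disappears. -/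
theorem pos_of_hasMellin_foxH_mul {G : FoxData} (hF : F.IsPositive) (hG : G.IsPositive)
    {ω μ ξ : ℝ} (hξ : 0 < ξ) {v : ℂ}
    (h : HasMellin (fun τ : ℝ => F.foxH (ξ * τ ^ μ) * G.foxH (1 * τ)) (ω : ℂ) v) :
    v.im = 0 ∧ 0 < v.re := by
  set g : ℝ → ℝ := fun τ => τ ^ (ω - 1) * ((F.foxH (ξ * τ ^ μ)).re * (G.foxH (1 * τ)).re) with hg
  have heq : EqOn
      (fun τ : ℝ => (τ : ℂ) ^ ((ω : ℂ) - 1) • (F.foxH (ξ * τ ^ μ) * G.foxH (1 * τ)))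
      (fun τ => (g τ : ℂ)) (Ioi 0) := fun τ hτ => by
    have hτ' : 0 < τ := hτ
    have h1 : F.foxH (ξ * τ ^ μ) = ((F.foxH (ξ * τ ^ μ)).re : ℂ) :=
      Complex.ext rfl (hF _ (by positivity)).1
    have h2 : G.foxH (1 * τ) = ((G.foxH (1 * τ)).re : ℂ) :=
      Complex.ext rfl (hG _ (by positivity)).1
    simp only [hg]
    rw [h1, h2, smul_eq_mul]
    push_cast
    rw [Complex.ofReal_cpow hτ'.le]
    simp
  have hpos : ∀ τ ∈ Ioi (0 : ℝ), 0 < g τ := fun τ hτ => by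
    have hτ' : 0 < τ := hτ
    have h1 := (hF (ξ * τ ^ μ) (by positivity)).2
    have h2 := (hG (1 * τ) (by positivity)).2
    positivity
  have hint : IntegrableOn g (Ioi 0) := by
    have := (h.1.congr_fun heq measurableSet_Ioi).re
    simpa [IntegrableOn] using this
  have hv : v = ((∫ τ in Ioi (0 : ℝ), g τ : ℝ) : ℂ) := by
    rw [← h.2, mellin, setIntegral_congr_fun measurableSet_Ioi heq]
    exact integral_ofReal
  rw [hv]
  refine ⟨Complex.ofReal_im _, ?_⟩
  rw [Complex.ofReal_re, setIntegral_pos_iff_support_of_nonneg_ae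
    (ae_restrict_of_forall_mem measurableSet_Ioi fun τ hτ => (hpos τ hτ).le) hint]
  have hsub : Ioi (0 : ℝ) ⊆ Function.support g ∩ Ioi 0 := fun τ hτ => ⟨(hpos τ hτ).ne', hτ⟩
  exact lt_of_lt_of_le (by simp) (measure_mono hsub)

end FoxData

/-! ### Extended-real bounds and the choice of a common line -/

namespace EReal

theorem coe_mul_lt_coe {lam : ℝ} (hlam : 0 < lam) {l : EReal} {c : ℝ} :
    (lam : EReal) * l < (c : EReal) ↔ l < ((c / lam : ℝ) : EReal) := by
  induction l with
  | bot => simp [EReal.coe_mul_bot_of_pos hlam]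
  | top => simp [EReal.coe_mul_top_of_pos hlam]
  | coe x =>
    rw [← EReal.coe_mul, EReal.coe_lt_coe_iff, EReal.coe_lt_coe_iff, lt_div_iff₀ hlam, mul_comm]

theorem coe_lt_coe_mul {lam : ℝ} (hlam : 0 < lam) {u : EReal} {c : ℝ} :
    (c : EReal) < (lam : EReal) * u ↔ ((c / lam : ℝ) : EReal) < u := by
  induction u with
  | bot => simp [EReal.coe_mul_bot_of_pos hlam]
  | top => simp [EReal.coe_mul_top_of_pos hlam]
  | coe x =>
    rw [← EReal.coe_mul, EReal.coe_lt_coe_iff, EReal.coe_lt_coe_iff, div_lt_iff₀ hlam, mul_comm]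

/-- Solved for c, the four conditions read max(l, w) < c < min(u, v) with v = (ω - l')/λ and w = (ω
- u')/λ. Infinite l' or u' give v = ⊤ or w = ⊥, so undefined differences in `EReal` never arise. -/
theorem exists_real_sub_mul_mem {l u l' u' : EReal} (h : l < u) (h' : l' < u') {lam ω : ℝ}
    (hlam : 0 < lam) (h1 : (lam : EReal) * l + l' < ω) (h2 : (ω : EReal) < lam * u + u') :
    ∃ c : ℝ, l < c ∧ (c : EReal) < u ∧ l' < ((ω - lam * c : ℝ) : EReal) ∧
      ((ω - lam * c : ℝ) : EReal) < u' := by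
  -- The last clause keeps what is needed for w < v once u' turns out to be finite.
  obtain ⟨v, hv, hv'⟩ : ∃ v : EReal, (∀ c : ℝ, (c : EReal) < v → l' < ((ω - lam * c : ℝ) : EReal)) ∧
      l < v ∧ ∀ r : ℝ, l' < (r : EReal) → (((ω - r) / lam : ℝ) : EReal) < v := by
    induction l' with
    | bot => exact ⟨⊤, fun c _ => EReal.bot_lt_coe _, h.trans_le le_top, fun r _ => EReal.coe_lt_top _⟩
    | top => exact absurd h' not_top_lt
    | coe x =>
      refine ⟨((ω - x) / lam : ℝ), fun c hc => ?_, ?_, fun r hr => ?_⟩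
      · rw [EReal.coe_lt_coe_iff, lt_div_iff₀ hlam] at hc
        rw [EReal.coe_lt_coe_iff]
        linarith
      · rw [← coe_mul_lt_coe hlam, EReal.coe_sub]
        exact EReal.lt_sub_iff_add_lt (by simp) (by simp) |>.2 h1
      · rw [EReal.coe_lt_coe_iff] at hr ⊢
        gcongr
  obtain ⟨w, hw, hwu, hwv⟩ : ∃ w : EReal,
      (∀ c : ℝ, w < (c : EReal) → ((ω - lam * c : ℝ) : EReal) < u') ∧ w < u ∧ w < v := by
    induction u' with
    | bot => exact absurd h' not_lt_bot
    | top =>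
      exact ⟨⊥, fun c _ => EReal.coe_lt_top _, bot_le.trans_lt h, bot_le.trans_lt hv'.1⟩
    | coe x =>
      refine ⟨((ω - x) / lam : ℝ), fun c hc => ?_, ?_, hv'.2 x h'⟩
      · rw [EReal.coe_lt_coe_iff, div_lt_iff₀ hlam] at hc
        rw [EReal.coe_lt_coe_iff]
        linarith
      · rw [← coe_lt_coe_mul hlam, EReal.coe_sub]
        exact EReal.sub_lt_of_lt_add h2
  obtain ⟨c, hc1, hc2⟩ := EReal.lt_iff_exists_real_btwn.1
    (max_lt (lt_min h hv'.1) (lt_min hwu hwv))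
  rw [max_lt_iff] at hc1
  rw [lt_min_iff] at hc2
  exact ⟨c, hc1.1, hc2.1, hv c hc2.2, hw c hc1.2⟩

theorem mul_add_lt_of_lt {l l' : EReal} {lam c d : ℝ} (hlam : 0 < lam) (h : l < c) (h' : l' < d) :
    (lam : EReal) * l + l' < ((lam * c + d : ℝ) : EReal) := by
  rw [EReal.coe_add]
  refine EReal.add_lt_add ((coe_mul_lt_coe hlam).2 ?_) h'
  rwa [mul_div_cancel_left₀ _ hlam.ne']

theorem lt_mul_add_of_lt {u u' : EReal} {lam c d : ℝ} (hlam : 0 < lam) (h : (c : EReal) < u)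
    (h' : (d : EReal) < u') : ((lam * c + d : ℝ) : EReal) < (lam : EReal) * u + u' := by
  rw [EReal.coe_add]
  refine EReal.add_lt_add ((coe_lt_coe_mul hlam).2 ?_) h'
  rwa [mul_div_cancel_left₀ _ hlam.ne']

end EReal

/-! ### Parameters, kernel and strip of the composite functions -/

namespace FoxData

variable {F G : FoxData} {lam ω : ℝ}

theorem product_p (hF : F.IsAdmissible) : (F.product G lam ω).p = F.p + G.q := by
  have := hF.n_le
  simp only [p, q, product, List.length_append, List.length_take, List.length_map,
    List.length_drop] at *
  omega

theorem product_q (hF : F.IsAdmissible) : (F.product G lam ω).q = F.q + G.p := by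
  have := hF.m_le
  simp only [p, q, product, List.length_append, List.length_take, List.length_map,
    List.length_drop] at *
  omega

theorem productInv_p (hF : F.IsAdmissible) : (F.productInv G lam ω).p = F.p + G.p := by
  have := hF.n_le
  simp only [p, productInv, List.length_append, List.length_take, List.length_map,
    List.length_drop] at *
  omega

theorem productInv_q (hF : F.IsAdmissible) : (F.productInv G lam ω).q = F.q + G.q := by
  have := hF.m_le
  simp only [q, productInv, List.length_append, List.length_take, List.length_map,
    List.length_drop] at *
  omega

theorem snd_pos_of_mem_insert {l : List (ℝ × ℝ)} {l' : List (ℝ × ℝ)} {f : ℝ × ℝ → ℝ × ℝ} (n : ℕ)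
    (h : ∀ x ∈ l, 0 < x.2) (h' : ∀ x ∈ l', 0 < (f x).2) :
    ∀ x ∈ l.take n ++ l'.map f ++ l.drop n, 0 < x.2 := by
  intro x hx
  simp only [List.mem_append, List.mem_map] at hx
  rcases hx with (hx | ⟨y, hy, rfl⟩) | hx
  · exact h x (List.mem_of_mem_take hx)
  · exact h' y hy
  · exact h x (List.mem_of_mem_drop hx)

theorem product_a_pos (hF : F.IsAdmissible) (hG : G.IsAdmissible) (hlam : 0 < lam) :
    ∀ x ∈ (F.product G lam ω).a, 0 < x.2 :=
  snd_pos_of_mem_insert _ hF.a_pos fun y hy => mul_pos hlam (hG.b_pos y hy)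

theorem product_b_pos (hF : F.IsAdmissible) (hG : G.IsAdmissible) (hlam : 0 < lam) :
    ∀ x ∈ (F.product G lam ω).b, 0 < x.2 :=
  snd_pos_of_mem_insert _ hF.b_pos fun y hy => mul_pos hlam (hG.a_pos y hy)

theorem productInv_a_pos (hF : F.IsAdmissible) (hG : G.IsAdmissible) (hlam : 0 < lam) :
    ∀ x ∈ (F.productInv G lam ω).a, 0 < x.2 :=
  snd_pos_of_mem_insert _ hF.a_pos fun y hy => mul_pos hlam (hG.a_pos y hy)

theorem productInv_b_pos (hF : F.IsAdmissible) (hG : G.IsAdmissible) (hlam : 0 < lam) :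
    ∀ x ∈ (F.productInv G lam ω).b, 0 < x.2 :=
  snd_pos_of_mem_insert _ hF.b_pos fun y hy => mul_pos hlam (hG.b_pos y hy)

theorem take_product_a (hF : F.IsAdmissible) (hG : G.IsAdmissible) :
    (F.product G lam ω).a.take (F.product G lam ω).n = F.a.take F.n ++
      (G.b.take G.m).map fun y => (1 - y.1 - ω * y.2, lam * y.2) := by
  rw [List.map_take]
  exact List.take_insert hF.n_le (hG.m_le.trans_eq (List.length_map _).symm)

theorem drop_product_a (hF : F.IsAdmissible) (hG : G.IsAdmissible) :
    (F.product G lam ω).a.drop (F.product G lam ω).n =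
      (G.b.drop G.m).map (fun y => (1 - y.1 - ω * y.2, lam * y.2)) ++ F.a.drop F.n := by
  rw [List.map_drop]
  exact List.drop_insert hF.n_le (hG.m_le.trans_eq (List.length_map _).symm)

theorem take_product_b (hF : F.IsAdmissible) (hG : G.IsAdmissible) :
    (F.product G lam ω).b.take (F.product G lam ω).m = F.b.take F.m ++
      (G.a.take G.n).map fun x => (1 - x.1 - ω * x.2, lam * x.2) := by
  rw [List.map_take]
  exact List.take_insert hF.m_le (hG.n_le.trans_eq (List.length_map _).symm)

theorem drop_product_b (hF : F.IsAdmissible) (hG : G.IsAdmissible) :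
    (F.product G lam ω).b.drop (F.product G lam ω).m =
      (G.a.drop G.n).map (fun x => (1 - x.1 - ω * x.2, lam * x.2)) ++ F.b.drop F.m := by
  rw [List.map_drop]
  exact List.drop_insert hF.m_le (hG.n_le.trans_eq (List.length_map _).symm)

theorem take_productInv_a (hF : F.IsAdmissible) (hG : G.IsAdmissible) :
    (F.productInv G lam ω).a.take (F.productInv G lam ω).n = F.a.take F.n ++
      (G.a.take G.n).map fun x => (x.1 + ω * x.2, lam * x.2) := by
  rw [List.map_take]
  exact List.take_insert hF.n_le (hG.n_le.trans_eq (List.length_map _).symm)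

theorem drop_productInv_a (hF : F.IsAdmissible) (hG : G.IsAdmissible) :
    (F.productInv G lam ω).a.drop (F.productInv G lam ω).n =
      (G.a.drop G.n).map (fun x => (x.1 + ω * x.2, lam * x.2)) ++ F.a.drop F.n := by
  rw [List.map_drop]
  exact List.drop_insert hF.n_le (hG.n_le.trans_eq (List.length_map _).symm)

theorem take_productInv_b (hF : F.IsAdmissible) (hG : G.IsAdmissible) :
    (F.productInv G lam ω).b.take (F.productInv G lam ω).m = F.b.take F.m ++
      (G.b.take G.m).map fun y => (y.1 + ω * y.2, lam * y.2) := by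
  rw [List.map_take]
  exact List.take_insert hF.m_le (hG.m_le.trans_eq (List.length_map _).symm)

theorem drop_productInv_b (hF : F.IsAdmissible) (hG : G.IsAdmissible) :
    (F.productInv G lam ω).b.drop (F.productInv G lam ω).m =
      (G.b.drop G.m).map (fun y => (y.1 + ω * y.2, lam * y.2)) ++ F.b.drop F.m := by
  rw [List.map_drop]
  exact List.drop_insert hF.m_le (hG.m_le.trans_eq (List.length_map _).symm)

/-- The upper and lower parameters of `G` change places, but χ is symmetric in them; the
coefficients are scaled by λ. -/
theorem chi_product (hF : F.IsAdmissible) (hG : G.IsAdmissible) :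
    (F.product G lam ω).chi = F.chi + lam * G.chi := by
  rw [chi, take_product_a hF hG, drop_product_a hF hG, take_product_b hF hG, drop_product_b hF hG]
  simp only [List.map_append, List.map_map, Function.comp_def, List.sum_append,
    List.sum_map_mul_left, chi]
  ring

theorem chi_productInv (hF : F.IsAdmissible) (hG : G.IsAdmissible) :
    (F.productInv G lam ω).chi = F.chi + lam * G.chi := by
  rw [chi, take_productInv_a hF hG, drop_productInv_a hF hG, take_productInv_b hF hG,
    drop_productInv_b hF hG]
  simp only [List.map_append, List.map_map, Function.comp_def, List.sum_append,
    List.sum_map_mul_left, chi]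
  ring

/-- The substitution s ↦ ω - λs reverses the sign of s, which makes each β + Bs factor of `G` one of
the form 1 - α - As and conversely. This is why its parameter lists are interchanged. -/
theorem kernel_product (hF : F.IsAdmissible) (hG : G.IsAdmissible) (s : ℂ) :
    (F.product G lam ω).kernel s = F.kernel s * G.kernel (ω - lam * s) := by
  have e1 (z w : ℝ) : 1 - ((1 - z - ω * w : ℝ) : ℂ) - ((lam * w : ℝ) : ℂ) * s =
      (z : ℂ) + (w : ℂ) * (ω - lam * s) := by
    push_cast
    ring
  have e2 (z w : ℝ) : ((1 - z - ω * w : ℝ) : ℂ) + ((lam * w : ℝ) : ℂ) * s =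
      1 - (z : ℂ) - (w : ℂ) * (ω - lam * s) := by
    push_cast
    ring
  rw [kernel_eq_mul, take_product_a hF hG, drop_product_a hF hG, take_product_b hF hG,
    drop_product_b hF hG, kernel_eq_mul, kernel_eq_mul]
  simp only [List.map_append, List.map_map, Function.comp_def, List.prod_append, e1, e2]
  ring

/-- Here μ = -λ, so s ↦ ω + λs preserves the type of every factor. The form `ω - (-lam) * s` matches
the Parseval formula. -/
theorem kernel_productInv (hF : F.IsAdmissible) (hG : G.IsAdmissible) (s : ℂ) :
    (F.productInv G lam ω).kernel s = F.kernel s * G.kernel (ω - (-lam : ℝ) * s) := by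
  have e1 (z w : ℝ) : 1 - ((z + ω * w : ℝ) : ℂ) - ((lam * w : ℝ) : ℂ) * s =
      1 - (z : ℂ) - (w : ℂ) * (ω - (-lam : ℝ) * s) := by
    push_cast
    ring
  have e2 (z w : ℝ) : ((z + ω * w : ℝ) : ℂ) + ((lam * w : ℝ) : ℂ) * s =
      (z : ℂ) + (w : ℂ) * (ω - (-lam : ℝ) * s) := by
    push_cast
    ring
  rw [kernel_eq_mul, take_productInv_a hF hG, drop_productInv_a hF hG, take_productInv_b hF hG,
    drop_productInv_b hF hG, kernel_eq_mul, kernel_eq_mul]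
  simp only [List.map_append, List.map_map, Function.comp_def, List.prod_append, e1, e2]
  ring

theorem mem_strip_product (hF : F.IsAdmissible) (hG : G.IsAdmissible) {c : ℝ} (hc : c ∈ F.strip)
    (hc' : ω - lam * c ∈ G.strip) : c ∈ (F.product G lam ω).strip := by
  simp only [strip, take_product_a hF hG, take_product_b hF hG, mem_ofPred_eq, List.mem_append,
    List.mem_map]
  constructor
  · rintro _ (hy | ⟨x, hx, rfl⟩)
    · exact hc.1 _ hy
    · linarith [hc'.2 x hx]
  · rintro _ (hx | ⟨y, hy, rfl⟩)
    · exact hc.2 _ hx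
    · linarith [hc'.1 y hy]

theorem mem_strip_productInv (hF : F.IsAdmissible) (hG : G.IsAdmissible) {c : ℝ}
    (hc : c ∈ F.strip) (hc' : ω - -lam * c ∈ G.strip) : c ∈ (F.productInv G lam ω).strip := by
  simp only [strip, take_productInv_a hF hG, take_productInv_b hF hG, mem_ofPred_eq,
    List.mem_append, List.mem_map]
  constructor
  · rintro _ (hy | ⟨y, hy, rfl⟩)
    · exact hc.1 _ hy
    · linarith [hc'.1 y hy]
  · rintro _ (hx | ⟨x, hx, rfl⟩)
    · exact hc.2 _ hx
    · linarith [hc'.2 x hx]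

theorem product_isAdmissible (hF : F.IsAdmissible) (hG : G.IsAdmissible) (hlam : 0 < lam) {c : ℝ}
    (hc : c ∈ (F.product G lam ω).strip) : (F.product G lam ω).IsAdmissible where
  n_le := (product_p hF (G := G)).symm ▸ add_le_add hF.n_le hG.m_le
  m_le := (product_q hF (G := G)).symm ▸ add_le_add hF.m_le hG.n_le
  a_pos := product_a_pos hF hG hlam
  b_pos := product_b_pos hF hG hlam
  poles_ne := poles_ne_of_mem_strip (product_a_pos hF hG hlam) (product_b_pos hF hG hlam) hc

theorem productInv_isAdmissible (hF : F.IsAdmissible) (hG : G.IsAdmissible) (hlam : 0 < lam)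
    {c : ℝ} (hc : c ∈ (F.productInv G lam ω).strip) : (F.productInv G lam ω).IsAdmissible where
  n_le := (productInv_p hF (G := G)).symm ▸ add_le_add hF.n_le hG.n_le
  m_le := (productInv_q hF (G := G)).symm ▸ add_le_add hF.m_le hG.m_le
  a_pos := productInv_a_pos hF hG hlam
  b_pos := productInv_b_pos hF hG hlam
  poles_ne :=
    poles_ne_of_mem_strip (productInv_a_pos hF hG hlam) (productInv_b_pos hF hG hlam) hc

theorem exists_omegaRange (hstripF : F.lower < F.upper) (hstripG : G.lower < G.upper)
    (hlam : 0 < lam) : ∃ ω : ℝ, F.OmegaRange G lam ω := by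
  obtain ⟨c, hc, hc'⟩ := EReal.lt_iff_exists_real_btwn.1 hstripF
  obtain ⟨d, hd, hd'⟩ := EReal.lt_iff_exists_real_btwn.1 hstripG
  exact ⟨lam * c + d, EReal.mul_add_lt_of_lt hlam hc hd, EReal.lt_mul_add_of_lt hlam hc' hd'⟩

/-- Reflecting the strip of `F` to (-upper, -lower) reduces the exponent -λ to the case of λ; the
point found there is afterwards negated. -/
theorem omegaRangeInv_iff : F.OmegaRangeInv G lam ω ↔
    (lam : EReal) * -F.upper + G.lower < (ω : EReal) ∧
      (ω : EReal) < (lam : EReal) * -F.lower + G.upper := by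
  rw [OmegaRangeInv, sub_eq_add_neg, sub_eq_add_neg, mul_neg, mul_neg, add_comm,
    add_comm G.upper]

theorem exists_omegaRangeInv (hstripF : F.lower < F.upper) (hstripG : G.lower < G.upper)
    (hlam : 0 < lam) : ∃ ω : ℝ, F.OmegaRangeInv G lam ω := by
  obtain ⟨c, hc, hc'⟩ := EReal.lt_iff_exists_real_btwn.1 (EReal.neg_lt_neg_iff.2 hstripF)
  obtain ⟨d, hd, hd'⟩ := EReal.lt_iff_exists_real_btwn.1 hstripG
  exact ⟨lam * c + d, omegaRangeInv_iff.2
    ⟨EReal.mul_add_lt_of_lt hlam hc hd, EReal.lt_mul_add_of_lt hlam hc' hd'⟩⟩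

theorem OmegaRange.exists_mem_strip (hF : F.IsAdmissible) (hG : G.IsAdmissible)
    (hstripF : F.lower < F.upper) (hstripG : G.lower < G.upper) (hlam : 0 < lam)
    (hω : F.OmegaRange G lam ω) : ∃ c ∈ F.strip, ω - lam * c ∈ G.strip := by
  obtain ⟨c, h1, h2, h3, h4⟩ := EReal.exists_real_sub_mul_mem hstripF hstripG hlam hω.1 hω.2
  exact ⟨c, (mem_strip_iff hF.a_pos hF.b_pos).2 ⟨h1, h2⟩,
    (mem_strip_iff hG.a_pos hG.b_pos).2 ⟨h3, h4⟩⟩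

theorem OmegaRangeInv.exists_mem_strip (hF : F.IsAdmissible) (hG : G.IsAdmissible)
    (hstripF : F.lower < F.upper) (hstripG : G.lower < G.upper) (hlam : 0 < lam)
    (hω : F.OmegaRangeInv G lam ω) : ∃ c ∈ F.strip, ω - -lam * c ∈ G.strip := by
  rw [omegaRangeInv_iff] at hω
  obtain ⟨c, h1, h2, h3, h4⟩ :=
    EReal.exists_real_sub_mul_mem (EReal.neg_lt_neg_iff.2 hstripF) hstripG hlam hω.1 hω.2
  refine ⟨-c, (mem_strip_iff hF.a_pos hF.b_pos).2 ⟨?_, ?_⟩, ?_⟩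
  · rwa [EReal.coe_neg, EReal.lt_neg_comm]
  · rwa [EReal.coe_neg, EReal.neg_lt_comm]
  · rw [neg_mul_neg]
    exact (mem_strip_iff hG.a_pos hG.b_pos).2 ⟨h3, h4⟩

end FoxData

/-! ### Conclusion for both signs of the exponent -/

theorem corollary4 (F G : FoxData) (hF : F.IsAdmissible) (hG : G.IsAdmissible)
    (hχF : 0 < F.chi) (hχG : 0 < G.chi)
    (hstripF : F.lower < F.upper) (hstripG : G.lower < G.upper)
    (hposF : F.IsPositive) (hposG : G.IsPositive)
    (lam : ℝ) (hlam : 0 < lam) :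
    ((∃ ω : ℝ, F.OmegaRange G lam ω) ∧
      ∀ ω : ℝ, F.OmegaRange G lam ω →
        (F.product G lam ω).p = F.p + G.q ∧ (F.product G lam ω).q = F.q + G.p ∧
        (F.product G lam ω).IsAdmissible ∧
        (∀ ξ ζ : ℝ, 0 < ξ → 0 < ζ →
          HasMellin (fun τ : ℝ => F.foxH (ξ * τ ^ lam) * G.foxH (ζ * τ)) (ω : ℂ)
            (((ζ ^ (-ω) : ℝ) : ℂ) * (F.product G lam ω).foxH (ξ * ζ ^ (-lam)))) ∧
        (F.product G lam ω).IsPositive) ∧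
    ((∃ ω : ℝ, F.OmegaRangeInv G lam ω) ∧
      ∀ ω : ℝ, F.OmegaRangeInv G lam ω →
        (F.productInv G lam ω).p = F.p + G.p ∧ (F.productInv G lam ω).q = F.q + G.q ∧
        (F.productInv G lam ω).IsAdmissible ∧
        (∀ ξ ζ : ℝ, 0 < ξ → 0 < ζ →
          HasMellin (fun τ : ℝ => F.foxH (ξ * τ ^ (-lam)) * G.foxH (ζ * τ)) (ω : ℂ)
            (((ζ ^ (-ω) : ℝ) : ℂ) * (F.productInv G lam ω).foxH (ξ * ζ ^ lam))) ∧
        (F.productInv G lam ω).IsPositive) := by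
  refine ⟨⟨FoxData.exists_omegaRange hstripF hstripG hlam, fun ω hω => ?_⟩,
    ⟨FoxData.exists_omegaRangeInv hstripF hstripG hlam, fun ω hω => ?_⟩⟩
  · obtain ⟨c, hcF, hcG⟩ := hω.exists_mem_strip hF hG hstripF hstripG hlam
    have hcP := FoxData.mem_strip_product hF hG hcF hcG
    have hP := FoxData.product_isAdmissible hF hG hlam hcP
    have hχ : 0 < (F.product G lam ω).chi := by
      rw [FoxData.chi_product hF hG]
      positivity
    have hmellin {ξ ζ : ℝ} (hξ : 0 < ξ) (hζ : 0 < ζ) :=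
      FoxData.hasMellin_foxH_mul hF hG hP.a_pos hP.b_pos hχF hχG hχ hcF hcG hcP
        (FoxData.kernel_product hF hG) hξ hζ
    refine ⟨FoxData.product_p hF, FoxData.product_q hF, hP, fun ξ ζ hξ hζ => hmellin hξ hζ,
      fun t ht => ?_⟩
    simpa using FoxData.pos_of_hasMellin_foxH_mul hposF hposG ht (hmellin ht one_pos)
  · obtain ⟨c, hcF, hcG⟩ := hω.exists_mem_strip hF hG hstripF hstripG hlam
    have hcP := FoxData.mem_strip_productInv hF hG hcF hcG
    have hP := FoxData.productInv_isAdmissible hF hG hlam hcP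
    have hχ : 0 < (F.productInv G lam ω).chi := by
      rw [FoxData.chi_productInv hF hG]
      positivity
    have hmellin {ξ ζ : ℝ} (hξ : 0 < ξ) (hζ : 0 < ζ) :=
      FoxData.hasMellin_foxH_mul hF hG hP.a_pos hP.b_pos hχF hχG hχ hcF hcG hcP
        (FoxData.kernel_productInv hF hG) hξ hζ
    refine ⟨FoxData.productInv_p hF, FoxData.productInv_q hF, hP,
      fun ξ ζ hξ hζ => ?_, fun t ht => ?_⟩
    · simpa only [neg_neg] using hmellin hξ hζ
    · simpa using FoxData.pos_of_hasMellin_foxH_mul hposF hposG ht (hmellin ht one_pos)
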